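/- A tournament $T=(V,E)$ is a directed graph with exactly one directed edge between any two distinct vertices (alternatives); write $a\succ b$ if $(a,b)\in E$ and $D(a)=\{b : a\succ b\}$. The uncovered set $\mathit{UC}(T)$ is the set of alternatives $x$ for which there is no $y\neq x$ with $D(x)\subseteq D(y)$; the set of $3$-kings consists of the alternatives that can reach every other alternative by a directed path of length at most $3$; the top cycle $\mathit{TC}(T)$ is the smallest nonempty set $B\subseteq V$ such that $a\succ b$ for all $a\in B$, $b\in V\setminus B$. Let $w:E\to\mathbb{R}_{>0}$ be a positive weight function, let $S$ be one of these three tournament solutions, and let $x\in S(T)$ be a winner. For $R\subseteq E$ let $T^R$ be the tournament obtained from $T$ by reversing all edges in $R$. The margin of victory of $x$ is $$\mathsf{MoV}_S(x,T)=\min\Big\{\sum_{e\in R}w(e) : R\subseteq E,\ x\notin S(T^R)\Big\}.$$ Then for each $S\in\{\mathit{UC},\,3\text{-kings},\,\mathit{TC}\}$ there is a polynomial-time algorithm which, given a tournament $T$ on $n\ge 2$ alternatives, positive edge weights $w$ and a winner $x\in S(T)$, computes $\mathsf{MoV}_S(x,T)$. Precisely: there are a program for a random access machine and a polynomial $p$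 such that on every such input the program outputs $\mathsf{MoV}_S(x,T)$ after at most $p(n)$ steps. Here the machine handles natural numbers (for counting and addressing) and the real weights with unit cost per operation, the only arithmetic on either sort being addition and subtraction (truncated at $0$ for natural numbers), besides copying, loading, storing and comparing; all constants in programs are natural numbers. -/

import Mathlib

/-! ### Tournaments and tournament solutions -/

/-- A tournament on the set `V` of alternatives: a digraph with exactly one directed edge between
any two distinct vertices (and no loops). `T.Adj a b` says that `a` dominates `b`. -/
structure Tournament (V : Type*) extends Digraph V where
  irrefl : ∀ a, ¬ Adj a a
  connex : ∀ a b, a ≠ b → Adj a b ∨ Adj b a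
  asymm : ∀ a b, Adj a b → ¬ Adj b a

namespace Tournament

variable {V : Type*}

/-- The edge set `E(T)`: ordered pairs `(a, b)` such that `a` dominates `b`. -/
abbrev Edge (T : Tournament V) : Type _ := {e : V × V // T.Adj e.1 e.2}

/-- The dominion `D(a)`: the alternatives dominated by `a`. -/
def dominion (T : Tournament V) (a : V) : Set V := {b | T.Adj a b}

/-- `a` covers the other alternative `b` if `D(b) ⊆ D(a)`. -/
def Covers (T : Tournament V) (a b : V) : Prop := a ≠ b ∧ T.dominion b ⊆ T.dominion a

/-- The uncovered set: the alternatives that no other alternative covers. -/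
def uncoveredSet (T : Tournament V) : Set V := {x | ∀ y, ¬ T.Covers y x}

/-- There is a directed path (without repeated vertices) of length `m` from `a` to `b`. -/
def HasPath (T : Tournament V) (m : ℕ) (a b : V) : Prop :=
  ∃ p : Fin (m + 1) → V, Function.Injective p ∧ p 0 = a ∧ p (Fin.last m) = b ∧
    ∀ i : Fin m, T.Adj (p i.castSucc) (p i.succ)

/-- The set of `k`-kings: the alternatives that can reach every other alternative via a directed
path of length at most `k`. -/
def kings (k : ℕ) (T : Tournament V) : Set V := {x | ∀ y, y ≠ x → ∃ m ≤ k, T.HasPath m x y}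

/-- `B` is a nonempty set of alternatives with `B ≻ V ∖ B`. -/
def IsDominant (T : Tournament V) (B : Set V) : Prop :=
  B.Nonempty ∧ ∀ a ∈ B, ∀ b ∉ B, T.Adj a b

/-- The top cycle: the smallest nonempty set `B` with `B ≻ V ∖ B`
(see `isLeast_topCycle`). -/
def topCycle (T : Tournament V) : Set V := ⋂₀ {B | T.IsDominant B}

theorem isLeast_topCycle [Finite V] [Nonempty V] (T : Tournament V) :
    IsLeast {B | T.IsDominant B} T.topCycle := by
  obtain ⟨B, hB⟩ := (Set.toFinite {B | T.IsDominant B}).exists_minimal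
    ⟨Set.univ, Set.univ_nonempty, fun _ _ b hb => absurd (Set.mem_univ b) hb⟩
  have hle : ∀ C ∈ {B | T.IsDominant B}, B ⊆ C := by
    intro C hC b hb
    by_contra hbC
    refine hbC (hB.2 hC (fun c hc => ?_) hb)
    by_contra hcB
    exact T.asymm b c (hB.1.2 b hb c hcB) (hC.2 c hc b hbC)
  have h : T.topCycle = B := Set.Subset.antisymm (Set.sInter_subset_of_mem hB.1)
    (Set.subset_sInter hle)
  exact h ▸ ⟨hB.1, hle⟩

/-! ### Reversal sets and the margin of victory -/

/-- The tournament `T^R` obtained from `T` by reversing all edges in `R ⊆ E(T)`: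
its edge set is `(E(T) ∖ R) ∪ R̄`. -/
def reverse (T : Tournament V) (R : Finset T.Edge) : Tournament V where
  Adj a b := (∃ h : T.Adj a b, ⟨(a, b), h⟩ ∉ R) ∨ ∃ h : T.Adj b a, ⟨(b, a), h⟩ ∈ R
  irrefl a := by
    rintro (⟨h, -⟩ | ⟨h, -⟩) <;> exact T.irrefl a h
  connex a b hab := by
    rcases T.connex a b hab with h | h
    · by_cases hR : (⟨(a, b), h⟩ : T.Edge) ∈ R
      · exact Or.inr (Or.inr ⟨h, hR⟩)
      · exact Or.inl (Or.inl ⟨h, hR⟩)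
    · by_cases hR : (⟨(b, a), h⟩ : T.Edge) ∈ R
      · exact Or.inl (Or.inr ⟨h, hR⟩)
      · exact Or.inr (Or.inl ⟨h, hR⟩)
  asymm a b := by
    rintro (⟨h, hR⟩ | ⟨h, hR⟩) (⟨h', hR'⟩ | ⟨h', hR'⟩)
    · exact T.asymm a b h h'
    · exact hR hR'
    · exact hR' hR
    · exact T.asymm a b h' h

/-- The cost `w(R)` of a set `R` of edges. -/
def cost (T : Tournament V) (w : T.Edge → ℝ) (R : Finset T.Edge) : ℝ := ∑ e ∈ R, w e

/-- `R` is a destructive reversal set for the winner `x` of `T` with respect to `S`. -/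
def IsDRS (S : Tournament V → Set V) (T : Tournament V) (x : V) (R : Finset T.Edge) : Prop :=
  x ∈ S T ∧ x ∉ S (T.reverse R)

/-- `R` is a constructive reversal set for the non-winner `x` of `T` with respect to `S`. -/
def IsCRS (S : Tournament V → Set V) (T : Tournament V) (x : V) (R : Finset T.Edge) : Prop :=
  x ∉ S T ∧ x ∈ S (T.reverse R)

/-- `v` is the margin of victory of `x` in the weighted tournament `(T, w)` with respect to `S`:
the minimum cost of a destructive reversal set if `x` is a winner, and the negative of the minimum
cost of a constructive reversal set otherwise (both minima being attained). -/
def IsMoV (S : Tournament V → Set V) (T : Tournament V) (w : T.Edge → ℝ) (x : V) (v : ℝ) : Prop :=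
  (x ∈ S T ∧ IsLeast {c | ∃ R, IsDRS S T x R ∧ c = T.cost w R} v) ∨
  (x ∉ S T ∧ IsLeast {c | ∃ R, IsCRS S T x R ∧ c = T.cost w R} (-v))

end Tournament

/-! ### The machine model

A random access machine with real-valued weights, programmed by structured programs. It has two
sorts of data: *indices* (natural numbers, used for counting and addressing) and *numbers* (real
numbers). For each sort there are registers and two-dimensional arrays with indirect addressing.
A program names only finitely many registers and arrays. Every instruction and every test costs one
unit of time. The arithmetic is addition and subtraction only, for both sorts (no multiplication,
division, rounding, or conversion between the sorts), and numbers can otherwise only be copied and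
compared. After `t` steps, every index is therefore at most `2 ^ t` times the maximum of the initial
indices and the constants of the program, and every number is an integer combination, with coefficients at most `2 ^ t` in absolute value altogether, of the
input numbers; so a polynomial number of steps also gives a polynomial bit complexity if the
input numbers are rational and encoded in binary. -/

/-- The contents of the memory of the machine. -/
structure RAMStore where
  /-- index registers -/
  idx : ℕ → ℕ
  /-- number registers -/
  num : ℕ → ℝ
  /-- index arrays: name, row, column -/
  idxArr : ℕ → ℕ → ℕ → ℕ
  /-- number arrays: name, row, column -/
  numArr : ℕ → ℕ → ℕ → ℝ

/-- The elementary instructions; arguments are names of registers and arrays,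
except for the constant `c` in `idxConst`. -/
inductive RAMInstr where
  /-- `idx[r] := c` -/
  | idxConst (r c : ℕ)
  /-- `idx[r] := idx[a]` -/
  | idxCopy (r a : ℕ)
  /-- `idx[r] := idx[a] + idx[b]` -/
  | idxAdd (r a b : ℕ)
  /-- `idx[r] := max (idx[a] - idx[b]) 0` -/
  | idxSub (r a b : ℕ)
  /-- `idx[r] := idxArr[A][idx[i], idx[j]]` -/
  | idxLoad (r A i j : ℕ)
  /-- `idxArr[A][idx[i], idx[j]] := idx[r]` -/
  | idxStore (A i j r : ℕ)
  /-- `num[r] := num[a]` -/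
  | numCopy (r a : ℕ)
  /-- `num[r] := num[a] + num[b]` -/
  | numAdd (r a b : ℕ)
  /-- `num[r] := num[a] - num[b]` -/
  | numSub (r a b : ℕ)
  /-- `num[r] := numArr[A][idx[i], idx[j]]` -/
  | numLoad (r A i j : ℕ)
  /-- `numArr[A][idx[i], idx[j]] := num[r]` -/
  | numStore (A i j r : ℕ)

/-- The effect of an elementary instruction on the memory. -/
noncomputable def RAMInstr.exec : RAMInstr → RAMStore → RAMStore
  | idxConst r c, σ => { σ with idx := Function.update σ.idx r c }
  | idxCopy r a, σ => { σ with idx := Function.update σ.idx r (σ.idx a) }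
  | idxAdd r a b, σ => { σ with idx := Function.update σ.idx r (σ.idx a + σ.idx b) }
  | idxSub r a b, σ => { σ with idx := Function.update σ.idx r (σ.idx a - σ.idx b) }
  | idxLoad r A i j, σ =>
      { σ with idx := Function.update σ.idx r (σ.idxArr A (σ.idx i) (σ.idx j)) }
  | idxStore A i j r, σ =>
      { σ with idxArr := fun B p q =>
          if B = A ∧ p = σ.idx i ∧ q = σ.idx j then σ.idx r else σ.idxArr B p q }
  | numCopy r a, σ => { σ with num := Function.update σ.num r (σ.num a) }
  | numAdd r a b, σ => { σ with num := Function.update σ.num r (σ.num a + σ.num b) }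
  | numSub r a b, σ => { σ with num := Function.update σ.num r (σ.num a - σ.num b) }
  | numLoad r A i j, σ =>
      { σ with num := Function.update σ.num r (σ.numArr A (σ.idx i) (σ.idx j)) }
  | numStore A i j r, σ =>
      { σ with numArr := fun B p q =>
          if B = A ∧ p = σ.idx i ∧ q = σ.idx j then σ.num r else σ.numArr B p q }

/-- The tests on which programs can branch. -/
inductive RAMTest where
  /-- `idx[a] < idx[b]` -/
  | idxLt (a b : ℕ)
  /-- `num[a] < num[b]` -/
  | numLt (a b : ℕ)

/-- The truth value of a test. -/
def RAMTest.Holds : RAMTest → RAMStore → Prop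
  | idxLt a b, σ => σ.idx a < σ.idx b
  | numLt a b, σ => σ.num a < σ.num b

/-- Programs. -/
inductive RAMProgram where
  | skip
  | instr (i : RAMInstr)
  | seq (P Q : RAMProgram)
  | ite (b : RAMTest) (P Q : RAMProgram)
  | loop (b : RAMTest) (P : RAMProgram)

/-- `P.Runs σ t σ'`: the program `P`, started with memory contents `σ`, halts after exactly `t`
steps with memory contents `σ'`. Here `loop b P` means "while `b` do `P`". Each execution of an
instruction, and each evaluation of a test, is one step. -/
inductive RAMProgram.Runs : RAMProgram → RAMStore → ℕ → RAMStore → Prop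
  | skip (σ : RAMStore) : Runs .skip σ 0 σ
  | instr (i : RAMInstr) (σ : RAMStore) : Runs (.instr i) σ 1 (i.exec σ)
  | seq {P Q : RAMProgram} {σ σ' σ'' : RAMStore} {s t : ℕ} :
      Runs P σ s σ' → Runs Q σ' t σ'' → Runs (.seq P Q) σ (s + t) σ''
  | iteTrue {b : RAMTest} {P Q : RAMProgram} {σ σ' : RAMStore} {t : ℕ} :
      b.Holds σ → Runs P σ t σ' → Runs (.ite b P Q) σ (t + 1) σ'
  | iteFalse {b : RAMTest} {P Q : RAMProgram} {σ σ' : RAMStore} {t : ℕ} :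
      ¬ b.Holds σ → Runs Q σ t σ' → Runs (.ite b P Q) σ (t + 1) σ'
  | loopTrue {b : RAMTest} {P : RAMProgram} {σ σ' σ'' : RAMStore} {s t : ℕ} :
      b.Holds σ → Runs P σ s σ' → Runs (.loop b P) σ' t σ'' → Runs (.loop b P) σ (s + t + 1) σ''
  | loopFalse {b : RAMTest} {P : RAMProgram} {σ : RAMStore} :
      ¬ b.Holds σ → Runs (.loop b P) σ 1 σ

/-- The machine is deterministic: running time and result are determined by the input. -/
theorem RAMProgram.Runs.unique {P : RAMProgram} {σ σ₁ σ₂ : RAMStore} {t₁ t₂ : ℕ}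
    (h₁ : P.Runs σ t₁ σ₁) (h₂ : P.Runs σ t₂ σ₂) : t₁ = t₂ ∧ σ₁ = σ₂ := by
  induction h₁ generalizing t₂ σ₂ with
  | skip => cases h₂; exact ⟨rfl, rfl⟩
  | instr => cases h₂; exact ⟨rfl, rfl⟩
  | seq _ _ ih ih' =>
    cases h₂ with
    | seq g g' =>
      obtain ⟨rfl, rfl⟩ := ih g
      obtain ⟨rfl, rfl⟩ := ih' g'
      exact ⟨rfl, rfl⟩
  | iteTrue hb _ ih =>
    cases h₂ with
    | iteTrue _ g => obtain ⟨rfl, rfl⟩ := ih g; exact ⟨rfl, rfl⟩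
    | iteFalse hb' _ => exact absurd hb hb'
  | iteFalse hb _ ih =>
    cases h₂ with
    | iteTrue hb' _ => exact absurd hb' hb
    | iteFalse _ g => obtain ⟨rfl, rfl⟩ := ih g; exact ⟨rfl, rfl⟩
  | loopTrue hb _ _ ih ih' =>
    cases h₂ with
    | loopTrue _ g g' =>
      obtain ⟨rfl, rfl⟩ := ih g
      obtain ⟨rfl, rfl⟩ := ih' g'
      exact ⟨rfl, rfl⟩
    | loopFalse hb' => exact absurd hb hb'
  | loopFalse hb =>
    cases h₂ with
    | loopTrue hb' _ _ => exact absurd hb' hb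
    | loopFalse _ => exact ⟨rfl, rfl⟩

/-! ### The computational problem -/

open Classical in
/-- The initial memory contents for a weighted tournament `(T, w)` with alternatives
`0, …, n - 1` and a distinguished alternative `x`: index register `0` holds `n`, index register `1`
holds `x`, index array `0` is the adjacency matrix of `T`, and number array `0` is the weight matrix
(with entry `0` where there is no edge). Everything else is `0`. -/
noncomputable def movInput {n : ℕ} (T : Tournament (Fin n)) (w : T.Edge → ℝ) (x : Fin n) :
    RAMStore where
  idx r := if r = 0 then n else if r = 1 then (x : ℕ) else 0
  num _ := 0
  idxArr A i j :=
    if A = 0 ∧ ∃ (hi : i < n) (hj : j < n), T.Adj ⟨i, hi⟩ ⟨j, hj⟩ then 1 else 0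
  numArr A i j :=
    if h : A = 0 ∧ ∃ (hi : i < n) (hj : j < n), T.Adj ⟨i, hi⟩ ⟨j, hj⟩ then
      w ⟨(⟨i, h.2.fst⟩, ⟨j, h.2.snd.fst⟩), h.2.snd.snd⟩
    else 0

/-- Computing the margin of victory of winners with respect to the tournament solution `S`, in the
weighted setting, can be done in polynomial time: one program, given any tournament on `n ≥ 2`
alternatives with positive edge weights and a winner `x`, halts within `p(n)` steps, for a fixed
polynomial `p`, with the margin of victory of `x` in number register `0`. -/
def WinnerMoVInPolyTime (S : ∀ n : ℕ, Tournament (Fin n) → Set (Fin n)) : Prop :=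
  ∃ (P : RAMProgram) (p : Polynomial ℕ), ∀ (n : ℕ), 2 ≤ n →
    ∀ (T : Tournament (Fin n)) (w : T.Edge → ℝ), (∀ e, 0 < w e) → ∀ x ∈ S n T,
      ∃ (t : ℕ) (σ : RAMStore), P.Runs (movInput T w x) t σ ∧ t ≤ p.eval n ∧
        Tournament.IsMoV (S n) T w x (σ.num 0)

/-! A winner `x` is expelled by a reversal set exactly when some `y ≠ x` witnesses this: `y` lies in
a dominant set that avoids `x`, or `y` covers `x`, or no path of length at most 3 leads from `x` to
`y`. For fixed `y`, the cheapest way to achieve this is a minimum cut from `x` to `y` in a suitable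
network, so the margin of victory is the least of these minimum cuts over all `y`. By
`isMoV_of_isLeast` two inequalities suffice: every cut yields a destructive reversal set that costs
no more, and every destructive reversal set dominates the value of some cut.

For the top cycle the network is `T` itself, and for the uncovered set it consists of the edges that
leave `x` or enter `y`. For 3-kings it has two copies of the alternatives and encodes the paths `x →
a → b → y` as well as `x → a → y` and `x → y`. Reversing differs from deleting, so one also has to
see that the reversed edges create no new short path (`notMem_kings_reverse`).

The cuts are found by a push-relabel method that only adds, subtracts and compares weights, so its
running time does not depend on their size. Labels are upside down: the source has label 0, the sink
label `N`, excess is pushed one level up, and relabelling decreases a label. A round sweeps the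
levels upwards and then relabels every node other than the sink that still has excess. Each round
lowers the sum of the labels until no excess remains at a positive label outside the sink, so `N *
N` rounds are enough. Some level strictly between source and sink is then empty, and the arcs across
this gap form a saturated cut (`IsPreflow.isLeast`).

The programs are verified with `Within`, a Hoare triple that carries a time bound; the bounds
compose to a polynomial. -/

/-! ### Cuts, preflows and labels. -/

open Finset in
/-- The capacity of the arcs that leave `C`, in the network with nodes `0, …, N - 1`. -/
def cutValue (N : ℕ) (c : ℕ → ℕ → ℝ) (C : Set ℕ) [DecidablePred (· ∈ C)] : ℝ :=
  ∑ u ∈ range N, ∑ v ∈ range N, if u ∈ C ∧ v ∉ C then c u v else 0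

open Classical in
/-- The capacities of the cuts that separate `s` from `t`. -/
def cutValues (N : ℕ) (c : ℕ → ℕ → ℝ) (s t : ℕ) : Set ℝ :=
  {z | ∃ C : Set ℕ, s ∈ C ∧ t ∉ C ∧ z = cutValue N c C}

/-- Residual capacities after pushing `δ` along `(u, v)`. -/
def pushRes (r : ℕ → ℕ → ℝ) (u v : ℕ) (δ : ℝ) (p q : ℕ) : ℝ :=
  r p q + (if p = v ∧ q = u then δ else 0) - (if p = u ∧ q = v then δ else 0)

/-- Excesses after pushing `δ` along `(u, v)`. -/
def pushExc (e : ℕ → ℝ) (u v : ℕ) (δ : ℝ) (p : ℕ) : ℝ :=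
  e p + (if p = v then δ else 0) - (if p = u then δ else 0)

/-- `r` are the residual capacities and `e` the excesses of a skew-symmetric flow function that
respects the capacities `c`. -/
structure IsPseudoflow (N : ℕ) (c r : ℕ → ℕ → ℝ) (e : ℕ → ℝ) : Prop where
  nonneg : ∀ u < N, ∀ v < N, 0 ≤ r u v
  skew : ∀ u < N, ∀ v < N, r u v + r v u = c u v + c v u
  balance : ∀ v < N, e v = ∑ u ∈ Finset.range N, (c u v - r u v)

theorem IsPseudoflow.push {N : ℕ} {c r : ℕ → ℕ → ℝ} {e : ℕ → ℝ} (h : IsPseudoflow N c r e)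
    {u v : ℕ} (hu : u < N) (hv : v < N) {δ : ℝ} (h0 : 0 ≤ δ) (h1 : δ ≤ r u v) :
    IsPseudoflow N c (pushRes r u v δ) (pushExc e u v δ) where
  nonneg p hp q hq := by
    have := h.nonneg p hp q hq
    unfold pushRes
    split_ifs with h2 h3 h3
    · linarith
    · linarith
    · rw [h3.1, h3.2]; linarith
    · linarith
  skew p hp q hq := by
    have := h.skew p hp q hq
    unfold pushRes
    simp only [and_comm (a := q = v), and_comm (a := q = u)]
    linarith
  balance q hq := by
    have h2 : ∀ p, c p q - pushRes r u v δ p q = (c p q - r p q) -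
        (if p = v then (if q = u then δ else 0) else 0) +
        (if p = u then (if q = v then δ else 0) else 0) := by
      intro p
      unfold pushRes
      simp only [ite_and]
      ring
    rw [Finset.sum_congr rfl fun p _ => h2 p, Finset.sum_add_distrib, Finset.sum_sub_distrib,
      ← h.balance q hq, Finset.sum_ite_eq', Finset.sum_ite_eq']
    simp only [Finset.mem_range, hu, hv, if_true]
    unfold pushExc
    ring

open Classical in
/-- The net flow into the complement of `C` crosses the cut. -/
theorem IsPseudoflow.sum_excess {N : ℕ} {c r : ℕ → ℕ → ℝ} {e : ℕ → ℝ} (h : IsPseudoflow N c r e)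
    (C : Set ℕ) :
    (∑ v ∈ Finset.range N, if v ∉ C then e v else 0) =
      ∑ u ∈ Finset.range N, ∑ v ∈ Finset.range N, if u ∈ C ∧ v ∉ C then c u v - r u v else 0 := by
  -- By skew symmetry the flow inside the complement of `C` is its own negative, hence 0.
  have key : ∑ u ∈ Finset.range N, ∑ v ∈ Finset.range N,
      (if u ∉ C ∧ v ∉ C then c u v - r u v else 0) = 0 := by
    have h1 : ∑ u ∈ Finset.range N, ∑ v ∈ Finset.range N,
        (if u ∉ C ∧ v ∉ C then c u v - r u v else 0) =
        - ∑ u ∈ Finset.range N, ∑ v ∈ Finset.range N,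
        (if u ∉ C ∧ v ∉ C then c u v - r u v else 0) := by
      conv_lhs => rw [Finset.sum_comm]
      rw [← Finset.sum_neg_distrib]
      refine Finset.sum_congr rfl fun u hu => ?_
      rw [← Finset.sum_neg_distrib]
      refine Finset.sum_congr rfl fun v hv => ?_
      have := h.skew u (Finset.mem_range.1 hu) v (Finset.mem_range.1 hv)
      by_cases a : u ∈ C <;> by_cases b : v ∈ C <;> simp [a, b]
      linarith
    linarith
  refine (?_ : _ = _ + _).trans ((congrArg₂ (· + ·) rfl key).trans (add_zero _))
  simp only [← Finset.sum_add_distrib]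
  rw [Finset.sum_comm]
  refine Finset.sum_congr rfl fun v hv => ?_
  rw [h.balance v (Finset.mem_range.1 hv)]
  by_cases b : v ∈ C
  · simp [b]
  · simp only [b, not_false_eq_true, if_true]
    refine Finset.sum_congr rfl fun u _ => ?_
    by_cases a : u ∈ C <;> simp [a]

/-- A preflow from `s` with a valid labelling `d`: no residual arc skips a level. -/
structure IsPreflow (N s t : ℕ) (c r : ℕ → ℕ → ℝ) (e : ℕ → ℝ) (d : ℕ → ℕ) : Prop
    extends IsPseudoflow N c r e where
  excess_nonneg : ∀ v < N, v ≠ s → 0 ≤ e v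
  label_source : d s = 0
  label_sink : d t = N
  label_le : ∀ v < N, d v ≤ N
  valid : ∀ u < N, ∀ v < N, 0 < r u v → d v ≤ d u + 1

/-- No node that can be relabelled has excess. -/
def Exhausted (N t : ℕ) (e : ℕ → ℝ) (d : ℕ → ℕ) : Prop := ∀ p < N, p ≠ t → 0 < d p → e p = 0

/-- The only residual arc that a push can create is the reverse one, which leads down a level and so
cannot violate validity. -/
theorem IsPreflow.push {N s t : ℕ} {c r : ℕ → ℕ → ℝ} {e : ℕ → ℝ} {d : ℕ → ℕ}
    (h : IsPreflow N s t c r e d) {u v : ℕ} (hu : u < N) (hv : v < N) (hd : d v = d u + 1)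
    {δ : ℝ} (h0 : 0 ≤ δ) (h1 : δ ≤ r u v) (h2 : δ ≤ e u) :
    IsPreflow N s t c (pushRes r u v δ) (pushExc e u v δ) d where
  toIsPseudoflow := h.toIsPseudoflow.push hu hv h0 h1
  excess_nonneg p hp hps := by
    have := h.excess_nonneg p hp hps
    unfold pushExc
    split_ifs with h3 h4 h4
    · linarith
    · linarith
    · rw [h4]; linarith
    · linarith
  label_source := h.label_source
  label_sink := h.label_sink
  label_le := h.label_le
  valid p hp q hq hr := by
    unfold pushRes at hr
    by_cases h3 : p = v ∧ q = u
    · rw [h3.1, h3.2]; omega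
    · apply h.valid p hp q hq
      rw [if_neg h3] at hr
      split_ifs at hr <;> linarith

/-- With no excess left, the excess of the sink is the capacity of a minimum cut. -/
theorem IsPreflow.isLeast {N s t : ℕ} {c r : ℕ → ℕ → ℝ} {e : ℕ → ℝ} {d : ℕ → ℕ}
    (h : IsPreflow N s t c r e d) (hs : s < N) (ht : t < N) (hE : Exhausted N t e d) :
    IsLeast (cutValues N c s t) (e t) := by
  classical
  have hsingle : ∀ C : Set ℕ, t ∉ C → (∀ v < N, v ∉ C → v ≠ t → e v = 0) →
      (∑ v ∈ Finset.range N, if v ∉ C then e v else 0) = e t := by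
    intro C htC hC
    rw [Finset.sum_eq_single t]
    · simp [htC]
    · intro v hv hvt
      by_cases hvC : v ∈ C
      · simp [hvC]
      · simp [hvC, hC v (Finset.mem_range.1 hv) hvC hvt]
    · intro ht'
      exact absurd (Finset.mem_range.2 ht) ht'
  constructor
  -- Pigeonhole: apart from `s` and `t` there are `N - 2` nodes, but `N - 1` levels strictly between
  -- 0 and `N`.
  · obtain ⟨k, hk1, hk2, hk⟩ : ∃ k, 1 ≤ k ∧ k < N ∧ ∀ p < N, d p ≠ k := by
      by_contra! hcon
      have hst : s ≠ t := by
        rintro rfl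
        have := h.label_source; have := h.label_sink; omega
      have hsub : Finset.Ico 1 N ⊆ (((Finset.range N).erase s).erase t).image d := by
        intro k hk
        obtain ⟨hk1, hk2⟩ := Finset.mem_Ico.1 hk
        obtain ⟨p, hp, hpk⟩ := hcon k hk1 hk2
        refine Finset.mem_image.2 ⟨p, ?_, hpk⟩
        refine Finset.mem_erase.2 ⟨?_, Finset.mem_erase.2 ⟨?_, Finset.mem_range.2 hp⟩⟩
        · rintro rfl
          have := h.label_sink; omega
        · rintro rfl
          have := h.label_source; omega
      have h1 := (Finset.card_le_card hsub).trans Finset.card_image_le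
      rw [Finset.card_erase_of_mem (Finset.mem_erase.2 ⟨hst.symm, Finset.mem_range.2 ht⟩),
        Finset.card_erase_of_mem (Finset.mem_range.2 hs), Finset.card_range, Nat.card_Ico] at h1
      omega
    -- An arc leaving this set skips the empty level `k`, so validity makes it saturated. Beyond the
    -- gap all labels are positive, so only the sink can have excess there.
    refine ⟨{p | d p < k}, ?_, ?_, ?_⟩
    · simp only [Set.mem_ofPred_eq, h.label_source]; omega
    · simp only [Set.mem_ofPred_eq, h.label_sink]; omega
    · rw [← hsingle {p | d p < k} (by simp only [Set.mem_ofPred_eq, h.label_sink]; omega),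
        h.sum_excess, cutValue]
      · refine Finset.sum_congr rfl fun u hu => Finset.sum_congr rfl fun v hv => ?_
        rw [Finset.mem_range] at hu hv
        split_ifs with huv
        · have h0 := h.nonneg u hu v hv
          have h1 : ¬ 0 < r u v := fun h1 => by
            have h2 := h.valid u hu v hv h1
            have h3 := hk v hv
            simp only [Set.mem_ofPred_eq] at huv
            omega
          linarith
        · rfl
      · intro v hv hvC hvt
        simp only [Set.mem_ofPred_eq] at hvC
        exact hE v hv hvt (by omega)
  · rintro z ⟨C, hsC, htC, rfl⟩
    -- Weak duality: the excess at the sink is at most the total excess beyond the cut, which is the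
    -- net flow across it.
    calc e t ≤ ∑ v ∈ Finset.range N, if v ∉ C then e v else 0 := by
          have h1 := Finset.single_le_sum (f := fun v => if v ∉ C then e v else 0)
            (s := Finset.range N) (fun v hv => by
              by_cases hvC : v ∈ C
              · simp [hvC]
              · simpa [hvC] using
                  h.excess_nonneg v (Finset.mem_range.1 hv) (fun hvs => hvC (hvs ▸ hsC))) (Finset.mem_range.2 ht)
          simpa only [htC, not_false_eq_true, if_true] using h1
      _ = _ := h.sum_excess C
      _ ≤ _ := by
          refine Finset.sum_le_sum fun u hu => Finset.sum_le_sum fun v hv => ?_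
          rw [Finset.mem_range] at hu hv
          have := h.nonneg u hu v hv
          split_ifs <;> linarith

/-- All arcs `(p, q)` to the next level that precede `(u, v)` in the order in which level `k` and
the levels before it are processed are saturated, or their tails have no excess. -/
def Discharged (N : ℕ) (r : ℕ → ℕ → ℝ) (e : ℕ → ℝ) (d : ℕ → ℕ) (k u v : ℕ) : Prop :=
  ∀ p < N, ∀ q < N, 1 ≤ d p → (d p < k ∨ d p = k ∧ (p < u ∨ p = u ∧ q < v)) → d q = d p + 1 →
    e p = 0 ∨ r p q = 0

/-- Pushing the minimum either empties `u` or saturates the arc. Excess grows only at `v`, one level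
above those processed so far, and residual capacity grows only on an arc leading down, so earlier
work is not undone. -/
theorem Discharged.push {N : ℕ} {r : ℕ → ℕ → ℝ} {e : ℕ → ℝ} {d : ℕ → ℕ} {k u v : ℕ}
    (h : Discharged N r e d k u v) (hr : 0 ≤ r u v) (hu : d u = k) (hv : d v = k + 1) :
    Discharged N (pushRes r u v (min (e u) (r u v))) (pushExc e u v (min (e u) (r u v))) d
      k u (v + 1) := by
  intro p hp q hq h1 h2 h3
  have hpv : p ≠ v := by rintro rfl; omega
  by_cases hpu : p = u
  · subst hpu
    by_cases hqv : q = v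
    · subst hqv
      rcases le_total (e p) (r p q) with h4 | h4
      · left; simp [pushExc, hpv, h4]
      · right; simp [pushRes, hpv, h4]
    · rcases h p hp q hq h1 (by omega) h3 with h4 | h4
      · left; simp [pushExc, hpv, h4, hr]
      · right; simp [pushRes, hpv, hqv, h4]
  · have h4 := h p hp q hq h1 (by omega) h3
    simpa [pushRes, pushExc, hpv, hpu] using h4

theorem Discharged.skip {N : ℕ} {r : ℕ → ℕ → ℝ} {e : ℕ → ℝ} {d : ℕ → ℕ} {k u v : ℕ}
    (h : Discharged N r e d k u v) (hd : ¬ (d u = k ∧ d v = k + 1)) :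
    Discharged N r e d k u (v + 1) := by
  intro p hp q hq h1 h2 h3
  refine h p hp q hq h1 ?_ h3
  by_contra hcon
  have h4 : d p = k ∧ p = u ∧ q = v := by omega
  obtain ⟨h4, rfl, rfl⟩ := h4
  omega

/-- The labels after relabelling all nodes with excess except the sink. -/
noncomputable def relabel (N t : ℕ) (e : ℕ → ℝ) (d : ℕ → ℕ) (p : ℕ) : ℕ :=
  if p = t then N else if p < N ∧ 0 < e p then d p - 1 else d p

theorem relabel_le {N t : ℕ} {e : ℕ → ℝ} {d : ℕ → ℕ} (ht : d t = N) (p : ℕ) :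
    relabel N t e d p ≤ d p := by
  unfold relabel
  split_ifs with h
  · rw [h, ht]
  · omega
  · omega

/-- After a full sweep, a node at a level from 1 to `N - 1` with excess has no residual arc to the
next level, which leaves room to lower its label by one. At label 0 the truncated subtraction
changes nothing, and from label `N` no arc leads higher. -/
theorem IsPreflow.relabel {N s t : ℕ} {c r : ℕ → ℕ → ℝ} {e : ℕ → ℝ} {d : ℕ → ℕ}
    (h : IsPreflow N s t c r e d) (hst : s ≠ t) (hD : Discharged N r e d N 0 0) :
    IsPreflow N s t c r e (relabel N t e d) where
  toIsPseudoflow := h.toIsPseudoflow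
  excess_nonneg := h.excess_nonneg
  label_source := by simp [_root_.relabel, hst, h.label_source]
  label_sink := by simp [_root_.relabel]
  label_le v hv := (relabel_le h.label_sink v).trans (h.label_le v hv)
  valid u hu v hv hr := by
    have h1 := relabel_le (e := e) h.label_sink v
    have h2 := h.valid u hu v hv hr
    have h3 := h.label_le v hv
    have h4 := hD u hu v hv
    by_cases h5 : u = t
    · simp only [_root_.relabel, h5, if_true] at *
      omega
    by_cases h6 : 0 < e u
    · rw [show _root_.relabel N t e d u = d u - 1 by simp [_root_.relabel, h5, h6, hu]]
      by_cases h7 : 1 ≤ d u ∧ d u < N ∧ d v = d u + 1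
      · rcases h4 h7.1 (by omega) h7.2.2 with h8 | h8 <;> linarith
      · omega
    · rw [show _root_.relabel N t e d u = d u by simp [_root_.relabel, h5, h6, hu]]
      omega

theorem Exhausted.relabel {N t : ℕ} {e : ℕ → ℝ} {d : ℕ → ℕ} (h : Exhausted N t e d)
    (ht : d t = N) : Exhausted N t e (relabel N t e d) := fun p hp hpt h0 =>
  h p hp hpt (h0.trans_le (relabel_le ht p))

/-- A round that leaves excess somewhere decreases the sum of the labels. -/
theorem exhausted_or_sum_relabel_lt {N s t : ℕ} {c r : ℕ → ℕ → ℝ} {e : ℕ → ℝ} {d : ℕ → ℕ}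
    (h : IsPreflow N s t c r e d) (hst : s ≠ t) :
    Exhausted N t e (relabel N t e d) ∨
      ∑ p ∈ Finset.range N, relabel N t e d p < ∑ p ∈ Finset.range N, d p := by
  by_contra! hcon
  obtain ⟨h1, h2⟩ := hcon
  apply h1
  intro p hp hpt h0
  by_contra he
  refine absurd h2 (not_le.2 (Finset.sum_lt_sum (fun q _ => relabel_le h.label_sink q)
    ⟨p, Finset.mem_range.2 hp, ?_⟩))
  have h3 : p ≠ s := by
    rintro rfl
    simp [_root_.relabel, hst, h.label_source] at h0
  have h4 := lt_of_le_of_ne (h.excess_nonneg p hp h3) (Ne.symm he)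
  simp only [_root_.relabel, hpt, hp, h4, and_self, if_true, if_false] at h0 ⊢
  omega

/-! ### A program logic with time bounds. -/

/-- `P`, started in `σ`, halts within `T` steps in a memory that satisfies `Q`. -/
def RAMProgram.Within (P : RAMProgram) (σ : RAMStore) (T : ℕ) (Q : RAMStore → Prop) : Prop :=
  ∃ (t : ℕ) (σ' : RAMStore), P.Runs σ t σ' ∧ t ≤ T ∧ Q σ'

namespace RAMProgram

theorem Within.mono {P : RAMProgram} {σ : RAMStore} {T T' : ℕ} {Q Q' : RAMStore → Prop}
    (h : P.Within σ T Q) (hT : T ≤ T') (hQ : ∀ σ', Q σ' → Q' σ') : P.Within σ T' Q' := by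
  obtain ⟨t, σ', h1, h2, h3⟩ := h
  exact ⟨t, σ', h1, h2.trans hT, hQ _ h3⟩

theorem within_skip {σ : RAMStore} {T : ℕ} {Q : RAMStore → Prop} (h : Q σ) :
    skip.Within σ T Q := ⟨0, σ, .skip σ, Nat.zero_le _, h⟩

theorem within_instr {i : RAMInstr} {σ : RAMStore} {Q : RAMStore → Prop} (h : Q (i.exec σ)) :
    (instr i).Within σ 1 Q := ⟨1, _, .instr i σ, le_rfl, h⟩

theorem Within.seq {P P' : RAMProgram} {σ : RAMStore} {T T' : ℕ} {Q : RAMStore → Prop}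
    (h : P.Within σ T fun σ' => P'.Within σ' T' Q) : (P.seq P').Within σ (T + T') Q := by
  obtain ⟨t, σ', h1, h2, t', σ'', h3, h4, h5⟩ := h
  exact ⟨t + t', σ'', .seq h1 h3, by omega, h5⟩

theorem within_ite {b : RAMTest} {P P' : RAMProgram} {σ : RAMStore} {T : ℕ}
    {Q : RAMStore → Prop} (h : b.Holds σ → P.Within σ T Q) (h' : ¬ b.Holds σ → P'.Within σ T Q) :
    (ite b P P').Within σ (T + 1) Q := by
  by_cases hb : b.Holds σ
  · obtain ⟨t, σ', h1, h2, h3⟩ := h hb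
    exact ⟨t + 1, σ', .iteTrue hb h1, by omega, h3⟩
  · obtain ⟨t, σ', h1, h2, h3⟩ := h' hb
    exact ⟨t + 1, σ', .iteFalse hb h1, by omega, h3⟩

/-- A sequence of instructions. -/
def block : List RAMInstr → RAMProgram
  | [] => skip
  | i :: l => seq (instr i) (block l)

/-- The effect of a sequence of instructions. -/
noncomputable def execBlock : List RAMInstr → RAMStore → RAMStore
  | [], σ => σ
  | i :: l, σ => execBlock l (i.exec σ)

theorem within_block {l : List RAMInstr} {σ : RAMStore} {T : ℕ} {Q : RAMStore → Prop}
    (hT : l.length ≤ T) (h : Q (execBlock l σ)) : (block l).Within σ T Q := by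
  induction l generalizing σ T with
  | nil => exact within_skip h
  | cons i l ih =>
    rw [List.length_cons] at hT
    exact (Within.seq (within_instr (ih le_rfl h))).mono (by omega) fun _ h => h

/-- Branching on the equality of two index registers. -/
def ifEq (a b : ℕ) (P P' : RAMProgram) : RAMProgram :=
  ite (.idxLt a b) P' (ite (.idxLt b a) P' P)

theorem within_ifEq {a b : ℕ} {P P' : RAMProgram} {σ : RAMStore} {T : ℕ} {Q : RAMStore → Prop}
    (h : σ.idx a = σ.idx b → P.Within σ T Q) (h' : σ.idx a ≠ σ.idx b → P'.Within σ T Q) :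
    (ifEq a b P P').Within σ (T + 2) Q := by
  refine within_ite (fun h1 => (h' (ne_of_lt h1)).mono (Nat.le_succ T) fun _ h => h) fun h1 =>
    within_ite (fun h2 => h' (ne_of_gt h2)) fun h2 => h ?_
  exact le_antisymm (not_lt.1 h2) (not_lt.1 h1)

/-- `for idx[i] := idx[a], …, idx[b] - 1 do P`, where index register `2` holds `1`. -/
def forLoop (i a b : ℕ) (P : RAMProgram) : RAMProgram :=
  seq (instr (.idxCopy i a)) (loop (.idxLt i b) (seq P (instr (.idxAdd i i 2))))

end RAMProgram

/-! ### Memory layout, loops and pushing along one arc. -/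

/-- The contents of the memory that do not change during the computation of a minimum cut. -/
@[ext] structure FlowCtx where
  /-- the edge weights -/
  weight : ℕ → ℕ → ℝ
  /-- the value of the best cut found so far -/
  best : ℝ
  /-- the constant `0` -/
  zero : ℝ
  /-- whether some cut has been found -/
  flag : ℕ

/-- The contents of the memory that represent a flow, without the index registers. -/
@[ext] structure FlowMem where
  /-- the part that does not change -/
  ctx : FlowCtx
  /-- residual capacities -/
  res : ℕ → ℕ → ℝ
  /-- excesses -/
  exc : ℕ → ℝ
  /-- labels -/
  lab : ℕ → ℕ

/-- The flow that the memory represents. -/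
def RAMStore.flow (σ : RAMStore) : FlowMem where
  ctx := ⟨σ.numArr 0, σ.num 0, σ.num 1, σ.idxArr 2 0 0⟩
  res := σ.numArr 1
  exc u := σ.numArr 2 u 0
  lab u := σ.idxArr 1 u 0

/-- The effect of pushing `δ` along `(u, v)`. -/
def FlowMem.push (m : FlowMem) (u v : ℕ) (δ : ℝ) : FlowMem :=
  { m with res := pushRes m.res u v δ, exc := pushExc m.exc u v δ }

namespace RAMProgram

/-- Nested loops use increasing counter registers: a body preserves all registers up to its own
counter, and the invariant sees only the `FlowMem`, so scratch index registers never matter. An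
iteration pays for the body, the increment and the test; the last 2 steps are the initial copy and
the final test. -/
theorem within_forLoop {i a b A B T : ℕ} {P : RAMProgram} {σ : RAMStore}
    (Inv : ℕ → FlowMem → Prop) (hi : 2 < i) (hb : b < i) (h2 : σ.idx 2 = 1) (hA : σ.idx a = A)
    (hB : σ.idx b = B) (hAB : A ≤ B) (h0 : Inv A σ.flow)
    (hP : ∀ j < B, A ≤ j → ∀ τ : RAMStore, (∀ r < i, τ.idx r = σ.idx r) → τ.idx i = j →
      Inv j τ.flow → P.Within τ T fun τ' => (∀ r ≤ i, τ'.idx r = τ.idx r) ∧ Inv (j + 1) τ'.flow) :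
    (forLoop i a b P).Within σ (B * (T + 2) + 2) fun τ =>
      (∀ r < i, τ.idx r = σ.idx r) ∧ Inv B τ.flow := by
  have key : ∀ k j, A ≤ j → j + k = B → ∀ τ : RAMStore, (∀ r < i, τ.idx r = σ.idx r) →
      τ.idx i = j → Inv j τ.flow →
      (loop (.idxLt i b) (seq P (instr (.idxAdd i i 2)))).Within τ (k * (T + 2) + 1) fun τ =>
        (∀ r < i, τ.idx r = σ.idx r) ∧ Inv B τ.flow := by
    intro k
    induction k with
    | zero =>
      intro j _ hj τ hτ hτi hI
      obtain rfl : j = B := by omega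
      refine ⟨1, τ, .loopFalse ?_, by omega, hτ, hI⟩
      change ¬ τ.idx i < τ.idx b
      rw [hτi, hτ b hb, hB]
      exact lt_irrefl _
    | succ k ih =>
      intro j hAj hj τ hτ hτi hI
      obtain ⟨t, τ', h3, h4, h5, h6⟩ := hP j (by omega) hAj τ hτ hτi hI
      have h7 : ((RAMInstr.idxAdd i i 2).exec τ').idx i = j + 1 := by
        simp [RAMInstr.exec, h5 i le_rfl, hτi, h5 2 hi.le, hτ 2 hi, h2]
      have h8 : ∀ r < i, ((RAMInstr.idxAdd i i 2).exec τ').idx r = σ.idx r := by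
        intro r hr
        simp [RAMInstr.exec, hr.ne, h5 r hr.le, hτ r hr]
      obtain ⟨t', τ'', h9, h10, h11⟩ := ih (j + 1) (by omega) (by omega) _ h8 h7 h6
      refine ⟨_, τ'', .loopTrue ?_ (.seq h3 (.instr _ _)) h9, ?_, h11⟩
      · change τ.idx i < τ.idx b
        rw [hτi, hτ b hb, hB]
        omega
      · rw [Nat.succ_mul]
        omega
  have h3 : ∀ r < i, ((RAMInstr.idxCopy i a).exec σ).idx r = σ.idx r := by
    intro r hr
    simp [RAMInstr.exec, hr.ne]
  refine (Within.seq (within_instr (key (B - A) A le_rfl (by omega) _ h3 ?_ h0))).mono ?_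
    fun _ h => h
  · simp [RAMInstr.exec, hA]
  · have := Nat.mul_le_mul_right (T + 2) (Nat.sub_le B A)
    omega

/-- Pushing `num[4]` along the arc `(idx[u], idx[v])`, where index register `3` holds `0`. -/
def transfer (u v : ℕ) : List RAMInstr :=
  [.numLoad 3 1 u v, .numSub 3 3 4, .numStore 1 u v 3,
   .numLoad 3 1 v u, .numAdd 3 3 4, .numStore 1 v u 3,
   .numLoad 3 2 u 3, .numSub 3 3 4, .numStore 2 u 3 3,
   .numLoad 3 2 v 3, .numAdd 3 3 4, .numStore 2 v 3 3]

theorem idx_execBlock_transfer (u v : ℕ) (σ : RAMStore) :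
    (execBlock (transfer u v) σ).idx = σ.idx := rfl

theorem flow_execBlock_transfer {u v : ℕ} {σ : RAMStore} (h3 : σ.idx 3 = 0) :
    (execBlock (transfer u v) σ).flow = σ.flow.push (σ.idx u) (σ.idx v) (σ.num 4) := by
  ext p q
  · rfl
  · rfl
  · rfl
  · rfl
  · simp only [execBlock, transfer, RAMInstr.exec, RAMStore.flow, FlowMem.push, pushRes,
      Function.update_apply]
    norm_num
    generalize σ.idx u = a
    generalize σ.idx v = b
    -- For a loop `u = v` the second load already sees the first store, and the two updates cancel.
    by_cases hab : a = b
    · subst hab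
      by_cases h : p = a ∧ q = a
      · rw [h.1, h.2]; simp
      · simp [h]
    · by_cases h1 : p = a ∧ q = b
      · rw [h1.1, h1.2]; simp [hab]
      · by_cases h2 : p = b ∧ q = a
        · rw [h2.1, h2.2]; simp [hab, Ne.symm hab]
        · simp [h1, h2]
  · simp only [execBlock, transfer, RAMInstr.exec, RAMStore.flow, FlowMem.push, pushExc,
      Function.update_apply, h3]
    norm_num
    generalize σ.idx u = a
    generalize σ.idx v = b
    by_cases hab : a = b
    · subst hab
      by_cases h : p = a
      · rw [h]; simp
      · simp [h]
    · by_cases h1 : p = a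
      · rw [h1]; simp [hab]
      · by_cases h2 : p = b
        · rw [h2]; simp [Ne.symm hab]
        · simp [h1, h2]
  · rfl

/-- Pushing as much as possible along the arc `(idx[11], idx[12])` if it leads from level
`idx[10]` to the next one. -/
def pushArc : RAMProgram :=
  seq (block [.idxLoad 13 1 11 3, .idxLoad 14 1 12 3, .idxAdd 15 10 2])
    (ifEq 13 10
      (ifEq 14 15
        (seq (block [.numLoad 2 2 11 3, .numLoad 3 1 11 12])
          (seq (ite (.numLt 2 3) (instr (.numCopy 4 2)) (instr (.numCopy 4 3)))
            (block (transfer 11 12))))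
        skip)
      skip)

theorem within_pushArc {σ : RAMStore} (h2 : σ.idx 2 = 1) (h3 : σ.idx 3 = 0) :
    pushArc.Within σ 23 fun τ => (∀ r ≤ 12, τ.idx r = σ.idx r) ∧
      τ.flow = if σ.flow.lab (σ.idx 11) = σ.idx 10 ∧ σ.flow.lab (σ.idx 12) = σ.idx 10 + 1 then
        σ.flow.push (σ.idx 11) (σ.idx 12)
          (min (σ.flow.exc (σ.idx 11)) (σ.flow.res (σ.idx 11) (σ.idx 12)))
      else σ.flow := by
  refine Within.seq (T := 3) (T' := 20) (within_block (by simp) ?_)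
  set σ₁ := execBlock [.idxLoad 13 1 11 3, .idxLoad 14 1 12 3, .idxAdd 15 10 2] σ with hσ₁
  have hf : ∀ r ≤ 12, σ₁.idx r = σ.idx r := by
    intro r hr
    have h13 : r ≠ 13 := by omega
    have h14 : r ≠ 14 := by omega
    have h15 : r ≠ 15 := by omega
    simp [hσ₁, execBlock, RAMInstr.exec, h13, h14, h15]
  have h13 : σ₁.idx 13 = σ.flow.lab (σ.idx 11) := by
    simp [hσ₁, execBlock, RAMInstr.exec, RAMStore.flow, h3]
  have h14 : σ₁.idx 14 = σ.flow.lab (σ.idx 12) := by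
    simp [hσ₁, execBlock, RAMInstr.exec, RAMStore.flow, h3]
  have h15 : σ₁.idx 15 = σ.idx 10 + 1 := by
    simp [hσ₁, execBlock, RAMInstr.exec, h2]
  have hm : σ₁.flow = σ.flow := rfl
  have hnum : σ₁.numArr = σ.numArr := rfl
  clear_value σ₁
  refine within_ifEq (T := 18) (fun h4 => within_ifEq (T := 16) (fun h5 => ?_) fun h5 => ?_)
    fun h4 => ?_
  · rw [h13, hf 10 (by norm_num)] at h4
    rw [h14, h15] at h5
    rw [if_pos ⟨h4, h5⟩]
    refine Within.seq (T := 2) (T' := 14) (within_block (by simp) ?_)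
    set σ₂ := execBlock [.numLoad 2 2 11 3, .numLoad 3 1 11 12] σ₁ with hσ₂
    have hf2 : σ₂.idx = σ₁.idx := rfl
    have hm2 : σ₂.flow = σ₁.flow := rfl
    have hn2 : σ₂.num 2 = σ.flow.exc (σ.idx 11) := by
      simp [hσ₂, execBlock, RAMInstr.exec, RAMStore.flow,
        hf 11, hf 3, h3, hnum]
    have hn3 : σ₂.num 3 = σ.flow.res (σ.idx 11) (σ.idx 12) := by
      simp [hσ₂, execBlock, RAMInstr.exec, RAMStore.flow,
        hf 11, hf 12, hnum]
    clear_value σ₂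
    refine Within.seq (T := 2) (T' := 12) ?_
    have key : ∀ σ₃ : RAMStore, σ₃.idx = σ₂.idx → σ₃.flow = σ₂.flow →
        σ₃.num 4 = min (σ₂.num 2) (σ₂.num 3) →
        (block (transfer 11 12)).Within σ₃ 12 fun τ => (∀ r ≤ 12, τ.idx r = σ.idx r) ∧
          τ.flow = σ.flow.push (σ.idx 11) (σ.idx 12)
            (min (σ.flow.exc (σ.idx 11)) (σ.flow.res (σ.idx 11) (σ.idx 12))) := by
      intro σ₃ hf3 hm3 hn4
      refine within_block (by simp [transfer]) ⟨fun r hr => ?_, ?_⟩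
      · rw [idx_execBlock_transfer, hf3, hf2, hf r hr]
      · rw [flow_execBlock_transfer (by rw [hf3, hf2, hf 3 (by norm_num), h3]), hm3, hm2, hm, hf3,
          hf2, hf 11 (by norm_num), hf 12 (by norm_num), hn4, hn2, hn3]
    refine within_ite (T := 1) (fun h6 => within_instr (key _ rfl rfl ?_)) fun h6 =>
      within_instr (key _ rfl rfl ?_)
    · simpa [RAMInstr.exec] using (le_of_lt h6)
    · simpa [RAMInstr.exec] using not_lt.1 h6
  · rw [h14, h15] at h5
    rw [if_neg fun h => h5 h.2]
    exact within_skip ⟨hf, hm⟩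
  · rw [h13, hf 10 (by norm_num)] at h4
    rw [if_neg fun h => h4 h.1]
    exact within_skip ⟨hf, hm⟩

end RAMProgram

/-! ### The push-relabel program. -/

namespace RAMProgram

/-- The time for `B` iterations of a loop with a body that takes time `T`. -/
def forTime (B T : ℕ) : ℕ := B * (T + 2) + 2

/-- The registers that are set during the computation of a minimum cut. -/
structure FlowRegs (σ : RAMStore) (N s t : ℕ) : Prop where
  one : σ.idx 2 = 1
  zero : σ.idx 3 = 0
  size : σ.idx 4 = N
  source : σ.idx 6 = s
  sink : σ.idx 7 = t

theorem FlowRegs.congr {σ τ : RAMStore} {N s t : ℕ} (h : FlowRegs σ N s t)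
    (hr : ∀ r < 8, τ.idx r = σ.idx r) : FlowRegs τ N s t where
  one := by rw [hr 2 (by norm_num), h.one]
  zero := by rw [hr 3 (by norm_num), h.zero]
  size := by rw [hr 4 (by norm_num), h.size]
  source := by rw [hr 6 (by norm_num), h.source]
  sink := by rw [hr 7 (by norm_num), h.sink]

/-- Pushing along all arcs, in the order of the levels of their tails. -/
def wave : RAMProgram := forLoop 10 2 4 (forLoop 11 3 4 (forLoop 12 3 4 pushArc))

theorem within_wave {σ : RAMStore} {N s t : ℕ} (hσ : FlowRegs σ N s t) (hN : 1 ≤ N)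
    {c : ℕ → ℕ → ℝ} (hm : IsPreflow N s t c σ.flow.res σ.flow.exc σ.flow.lab) :
    wave.Within σ (forTime N (forTime N (forTime N 23))) fun τ =>
      (∀ r < 10, τ.idx r = σ.idx r) ∧ τ.flow.ctx = σ.flow.ctx ∧ τ.flow.lab = σ.flow.lab ∧
      IsPreflow N s t c τ.flow.res τ.flow.exc σ.flow.lab ∧
      Discharged N τ.flow.res τ.flow.exc σ.flow.lab N 0 0 ∧
      (Exhausted N t σ.flow.exc σ.flow.lab → Exhausted N t τ.flow.exc σ.flow.lab) := by
  set d := σ.flow.lab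
  set κ := σ.flow.ctx
  set D := Exhausted N t σ.flow.exc d
  let Inv (k u v : ℕ) (m : FlowMem) : Prop := m.ctx = κ ∧ m.lab = d ∧
    IsPreflow N s t c m.res m.exc d ∧ Discharged N m.res m.exc d k u v ∧
    (D → Exhausted N t m.exc d)
  -- The triple `(k, u, v)` is the lexicographic position of the sweep. If the flow is exhausted,
  -- every push in the sweep has amount 0, so it stays exhausted.
  have step : ∀ k < N, 1 ≤ k → ∀ u < N, ∀ v < N, ∀ m, Inv k u v m →
      Inv k u (v + 1) (if m.lab u = k ∧ m.lab v = k + 1 then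
        m.push u v (min (m.exc u) (m.res u v)) else m) := by
    rintro k hk hk1 u hu v hv m ⟨h1, h2, h3, h4, h5⟩
    rw [h2]
    split_ifs with h6
    · have hr := h3.nonneg u hu v hv
      have hus : u ≠ s := by
        rintro rfl
        have := h3.label_source
        omega
      have he := h3.excess_nonneg u hu hus
      refine ⟨h1, h2, h3.push hu hv (by omega) (le_min he hr) (min_le_right _ _)
        (min_le_left _ _), h4.push hr h6.1 h6.2, fun hD p hp hpt hp0 => ?_⟩
      have hut : u ≠ t := by
        rintro rfl
        have := h3.label_sink
        omega
      have h7 := h5 hD u hu hut (by omega)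
      have h8 := h5 hD p hp hpt hp0
      simp [FlowMem.push, pushExc, h7, h8, hr]
    · exact ⟨h1, h2, h3, h4.skip h6, h5⟩
  have next : ∀ k u m, Inv k u N m → Inv k (u + 1) 0 m := by
    rintro k u m ⟨h1, h2, h3, h4, h5⟩
    refine ⟨h1, h2, h3, fun p hp q hq h6 h7 h8 => h4 p hp q hq h6 ?_ h8, h5⟩
    omega
  have next' : ∀ k m, Inv k N 0 m → Inv (k + 1) 0 0 m := by
    rintro k m ⟨h1, h2, h3, h4, h5⟩
    refine ⟨h1, h2, h3, fun p hp q hq h6 h7 h8 => h4 p hp q hq h6 ?_ h8, h5⟩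
    omega
  -- The register holding the constant 1 serves as the lower bound: level 0 is never discharged.
  refine (within_forLoop (fun k => Inv k 0 0) (by norm_num) (by norm_num) hσ.one hσ.one hσ.size hN
    ⟨rfl, rfl, hm, fun p hp q hq h6 h7 h8 => by omega, fun h => h⟩
    fun k hk hk1 τ hτ hτk hI => ?_).mono le_rfl fun _ h => h
  have hτ' := hσ.congr fun r hr => hτ r (by omega)
  refine (within_forLoop (fun u => Inv k u 0) (by norm_num) (by norm_num) hτ'.one hτ'.zero
    hτ'.size (Nat.zero_le _) hI fun u hu _ ρ hρ hρu hI => ?_).mono le_rfl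
    fun _ h => ⟨fun r hr => h.1 r (by omega), next' _ _ h.2⟩
  have hρ' := hτ'.congr fun r hr => hρ r (by omega)
  refine (within_forLoop (fun v => Inv k u v) (by norm_num) (by norm_num) hρ'.one hρ'.zero
    hρ'.size (Nat.zero_le _) hI fun v hv _ π hπ hπv hI => ?_).mono le_rfl
    fun _ h => ⟨fun r hr => h.1 r (by omega), next _ _ _ h.2⟩
  have hπ' := hρ'.congr fun r hr => hπ r (by omega)
  refine (within_pushArc hπ'.one hπ'.zero).mono le_rfl fun _ h => ⟨h.1, ?_⟩
  rw [h.2, hπ 11 (by norm_num), hρu, hπv, hπ 10 (by norm_num), hρ 10 (by norm_num), hτk]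
  exact step k hk hk1 u hu v hv _ hI

/-- Relabelling all nodes with excess except the sink. -/
def relabelNodes : RAMProgram :=
  seq (forLoop 11 3 4
    (seq (block [.idxLoad 13 1 11 3, .numLoad 2 2 11 3, .idxSub 13 13 2])
      (ite (.numLt 1 2) (instr (.idxStore 1 11 3 13)) skip)))
    (instr (.idxStore 1 7 3 4))

theorem within_relabelNodes {σ : RAMStore} {N s t : ℕ} (hσ : FlowRegs σ N s t)
    (hz : σ.flow.ctx.zero = 0) :
    relabelNodes.Within σ (forTime N 5 + 1) fun τ =>
      (∀ r < 11, τ.idx r = σ.idx r) ∧ τ.flow.ctx = σ.flow.ctx ∧ τ.flow.res = σ.flow.res ∧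
      τ.flow.exc = σ.flow.exc ∧ τ.flow.lab = relabel N t σ.flow.exc σ.flow.lab := by
  set d := σ.flow.lab
  set e := σ.flow.exc
  have hloop := within_forLoop
    (P := seq (block [.idxLoad 13 1 11 3, .numLoad 2 2 11 3, .idxSub 13 13 2])
      (ite (.numLt 1 2) (instr (.idxStore 1 11 3 13)) skip)) (T := 5) (i := 11)
    (fun j m => m.ctx = σ.flow.ctx ∧ m.res = σ.flow.res ∧ m.exc = e ∧
      ∀ p, m.lab p = if p < j ∧ 0 < e p then d p - 1 else d p) (by norm_num) (by norm_num)
    hσ.one hσ.zero hσ.size (Nat.zero_le _) ⟨rfl, rfl, rfl, fun p => by simp [d]⟩ ?_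
  · refine Within.seq (hloop.mono le_rfl fun τ h => within_instr ?_)
    obtain ⟨h1, h2, h3, h4, h5⟩ := h
    have hτ := hσ.congr fun r hr => h1 r (by omega)
    refine ⟨h1, h2, h3, h4, ?_⟩
    ext p
    -- The loop may have lowered the sink too; the final store restores its label `N`.
    have h6 : ((RAMInstr.idxStore 1 7 3 4).exec τ).flow.lab p =
        if p = t then N else τ.flow.lab p := by
      simp [RAMInstr.exec, RAMStore.flow, hτ.sink, hτ.zero, hτ.size]
    rw [h6, h5, relabel]
  · intro j hj _ τ hτ hτj hI
    obtain ⟨h2, h3, h4, h5⟩ := hI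
    have hτ' := hσ.congr fun r hr => hτ r (by omega)
    refine Within.seq (T := 3) (T' := 2) (within_block (by simp) ?_)
    set σ₁ := execBlock [.idxLoad 13 1 11 3, .numLoad 2 2 11 3, .idxSub 13 13 2] τ with hσ₁
    have hf : ∀ r ≤ 12, σ₁.idx r = τ.idx r := by
      intro r hr
      have h13 : r ≠ 13 := by omega
      simp [hσ₁, execBlock, RAMInstr.exec, h13]
    have h13 : σ₁.idx 13 = d j - 1 := by
      have : τ.flow.lab j = d j := by simp [h5]
      rw [← this]
      simp [hσ₁, execBlock, RAMInstr.exec, RAMStore.flow, hτ'.one, hτ'.zero, hτj]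
    have hn2 : σ₁.num 2 = e j := by
      rw [← h4]
      simp [hσ₁, execBlock, RAMInstr.exec, RAMStore.flow, hτ'.zero, hτj]
    have hm : σ₁.flow = τ.flow := rfl
    clear_value σ₁
    have hn1 : σ₁.num 1 = 0 := by
      change σ₁.flow.ctx.zero = 0
      rw [hm, h2, hz]
    refine within_ite (T := 1) (fun h => within_instr ⟨fun r hr => hf r (by omega), ?_⟩)
      fun h => within_skip ⟨fun r hr => hf r (by omega), ?_⟩
    · change σ₁.num 1 < σ₁.num 2 at h
      rw [hn1, hn2] at h
      refine ⟨h2 ▸ hm ▸ rfl, h3 ▸ hm ▸ rfl, h4 ▸ hm ▸ rfl, fun p => ?_⟩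
      have h6 : ((RAMInstr.idxStore 1 11 3 13).exec σ₁).flow.lab p =
          if p = j then d j - 1 else τ.flow.lab p := by
        rw [← hm]
        simp [RAMInstr.exec, RAMStore.flow, hf 11, hf 3, hτj, hτ'.zero, h13]
      rw [h6, h5]
      by_cases hpj : p = j
      · subst hpj; simp [h]
      · simp [hpj, show p < j + 1 ↔ p < j by omega]
    · change ¬ σ₁.num 1 < σ₁.num 2 at h
      rw [hn1, hn2] at h
      rw [hm]
      refine ⟨h2, h3, h4, fun p => ?_⟩
      rw [h5]
      by_cases hpj : p = j
      · subst hpj; simp [h]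
      · simp [show p < j + 1 ↔ p < j by omega]

/-- Computing a maximum preflow. -/
def pushRelabel : RAMProgram := forLoop 8 3 4 (forLoop 9 3 4 (seq wave relabelNodes))

/-- The running time of `pushRelabel`. -/
def pushRelabelTime (N : ℕ) : ℕ :=
  forTime N (forTime N (forTime N (forTime N (forTime N 23)) + (forTime N 5 + 1)))

theorem within_pushRelabel {σ : RAMStore} {N s t : ℕ} (hσ : FlowRegs σ N s t) (hs : s < N)
    (ht : t < N) (hst : s ≠ t) (hz : σ.flow.ctx.zero = 0) {c : ℕ → ℕ → ℝ}
    (hm : IsPreflow N s t c σ.flow.res σ.flow.exc σ.flow.lab) :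
    pushRelabel.Within σ (pushRelabelTime N) fun τ =>
      (∀ r < 8, τ.idx r = σ.idx r) ∧ τ.flow.ctx = σ.flow.ctx ∧
      IsLeast (cutValues N c s t) (τ.flow.exc t) := by
  -- Here `k` counts completed rounds; the two nested loops serve to reach `N * N` of them.
  let Inv (k : ℕ) (m : FlowMem) : Prop := m.ctx = σ.flow.ctx ∧
    IsPreflow N s t c m.res m.exc m.lab ∧
    (Exhausted N t m.exc m.lab ∨ ∑ p ∈ Finset.range N, m.lab p + k ≤ N * N)
  have hinit : Inv 0 σ.flow := by
    refine ⟨rfl, hm, Or.inr ?_⟩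
    have := Finset.sum_le_card_nsmul (Finset.range N) σ.flow.lab N fun p hp =>
      hm.label_le p (Finset.mem_range.1 hp)
    simpa using this
  refine (within_forLoop (fun i => Inv (i * N)) (by norm_num) (by norm_num) hσ.one hσ.zero hσ.size
    (Nat.zero_le _) (by simpa using hinit)
    fun i hi _ τ hτ hτi hI => ?_).mono le_rfl fun τ h => ?_
  · have hτ' := hσ.congr fun r hr => hτ r (by omega)
    refine (within_forLoop (fun j => Inv (i * N + j)) (by norm_num) (by norm_num) hτ'.one hτ'.zero
      hτ'.size (Nat.zero_le _) hI fun j hj _ ρ hρ hρj hI => ?_).mono le_rfl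
      fun _ h => ⟨fun r hr => h.1 r (by omega), by rw [Nat.succ_mul]; exact h.2⟩
    have hρ' := hτ'.congr fun r hr => hρ r (by omega)
    obtain ⟨h1, h2, h3⟩ := hI
    refine Within.seq ((within_wave hρ' (by omega) h2).mono le_rfl fun π h => ?_)
    obtain ⟨h4, h5, h6, h7, h8, h9⟩ := h
    have hπ' := hρ'.congr fun r hr => h4 r (by omega)
    refine (within_relabelNodes hπ' (by rw [h5, h1, hz])).mono le_rfl fun α h => ?_
    obtain ⟨h10, h11, h12, h13, h14⟩ := h
    refine ⟨fun r hr => (h10 r (by omega)).trans (h4 r (by omega)),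
      h11.trans (h5.trans h1), ?_, ?_⟩
    · rw [h12, h13, h14, h6]
      exact h7.relabel hst h8
    · rw [h13, h14, h6]
      rcases h3 with h3 | h3
      · exact Or.inl ((h9 h3).relabel h7.label_sink)
      · exact (exhausted_or_sum_relabel_lt h7 hst).imp id fun h => by omega
  · obtain ⟨h1, h2, h3, h4⟩ := h
    -- Otherwise the labels would sum to 0 after `N * N` rounds, whereas the sink alone contributes
    -- `N`.
    refine ⟨h1, h2, h3.isLeast hs ht (h4.resolve_right fun h => ?_)⟩
    have h5 := Finset.single_le_sum (f := τ.flow.lab) (fun _ _ => Nat.zero_le _)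
      (Finset.mem_range.2 ht)
    rw [h3.label_sink] at h5
    omega

/-- Turning the capacities into the initial preflow. -/
def initFlow : RAMProgram :=
  seq (forLoop 11 3 4 (block [.numStore 2 11 3 1, .idxStore 1 11 3 4]))
    (seq (instr (.idxStore 1 6 3 3)) (forLoop 12 3 4 (block (.numLoad 4 1 6 12 :: transfer 6 12))))

/-- The running time of `initFlow`. -/
def initFlowTime (N : ℕ) : ℕ := forTime N 2 + (1 + forTime N 13)

/-- Label 0 at the source and `N` elsewhere is valid because all arcs from the source to other nodes
are saturated first. -/
theorem within_initFlow {σ : RAMStore} {N s t : ℕ} (hσ : FlowRegs σ N s t) (hs : s < N)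
    (ht : t < N) (hst : s ≠ t) (hz : σ.flow.ctx.zero = 0) {c : ℕ → ℕ → ℝ}
    (hc : ∀ u < N, ∀ v < N, 0 ≤ c u v)
    (hm : ∀ u < N, ∀ v < N, σ.flow.res u v = c u v) :
    initFlow.Within σ (initFlowTime N) fun τ =>
      (∀ r < 8, τ.idx r = σ.idx r) ∧ τ.flow.ctx = σ.flow.ctx ∧
      IsPreflow N s t c τ.flow.res τ.flow.exc τ.flow.lab := by
  refine Within.seq (T := forTime N 2) ((within_forLoop (fun j m => m.ctx = σ.flow.ctx ∧
    m.res = σ.flow.res ∧ ∀ p < j, m.exc p = 0 ∧ m.lab p = N) (by norm_num) (by norm_num) hσ.one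
    hσ.zero hσ.size (Nat.zero_le _) ⟨rfl, rfl, fun p hp => absurd hp (Nat.not_lt_zero p)⟩
    fun j hj _ τ hτ hτj hI => within_block le_rfl ⟨fun r hr => rfl, ?_⟩).mono le_rfl
    fun τ h => ?_)
  · obtain ⟨h1, h2, h3⟩ := hI
    have hτ' := hσ.congr fun r hr => hτ r (by omega)
    have hn1 : τ.num 1 = 0 := by
      change τ.flow.ctx.zero = 0
      rw [h1, hz]
    refine ⟨h1, h2, fun p hp => ?_⟩
    by_cases hpj : p = j
    · simp [execBlock, RAMInstr.exec, RAMStore.flow, hτj, hτ'.zero, hτ'.size, hn1, hpj]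
    · have h4 := h3 p (by omega)
      simpa [execBlock, RAMInstr.exec, RAMStore.flow, hτj, hτ'.zero, hpj] using h4
  obtain ⟨h1, h2, h3, h4⟩ := h
  have hτ := hσ.congr fun r hr => h1 r (by omega)
  refine Within.seq (T := 1) (within_instr ?_)
  set τ' := (RAMInstr.idxStore 1 6 3 3).exec τ with hτ'
  have h5 : τ'.idx = τ.idx := rfl
  have h6 : τ'.flow = { τ.flow with lab := fun p => if p = s then 0 else τ.flow.lab p } := by
    ext p <;> simp [hτ', RAMInstr.exec, RAMStore.flow, hτ.source, hτ.zero]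
  clear_value τ'
  have hτ2 := hτ.congr (τ := τ') fun r hr => by rw [h5]
  refine (within_forLoop (T := 13) (fun j m => m.ctx = σ.flow.ctx ∧ m.lab s = 0 ∧
    (∀ p < N, p ≠ s → m.lab p = N) ∧ IsPseudoflow N c m.res m.exc ∧
    (∀ p < N, p ≠ s → 0 ≤ m.exc p) ∧ ∀ q < j, q ≠ s → m.res s q = 0)
    (by norm_num) (by norm_num) hτ2.one hτ2.zero hτ2.size (Nat.zero_le _) ?_
    fun j hj _ ρ hρ hρj hI => within_block (by simp [transfer]) ?_).mono le_rfl fun ρ h => ?_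
  · rw [h6]
    refine ⟨h2, by simp, fun p hp hps => by simp [hps, h4 p hp], ⟨fun u hu v hv => ?_,
      fun u hu v hv => ?_, fun v hv => ?_⟩, fun p hp _ => (h4 p hp).1.ge,
      fun q hq => absurd hq (Nat.not_lt_zero q)⟩
    · change 0 ≤ τ.flow.res u v
      rw [h3, hm u hu v hv]
      exact hc u hu v hv
    · change τ.flow.res u v + τ.flow.res v u = _
      rw [h3, hm u hu v hv, hm v hv u hu]
    · change τ.flow.exc v = _
      rw [(h4 v hv).1]
      refine (Finset.sum_eq_zero fun u hu => ?_).symm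
      change c u v - τ.flow.res u v = 0
      rw [h3, hm u (Finset.mem_range.1 hu) v hv, sub_self]
  · obtain ⟨h7, h8, h9, h10, h11, h12⟩ := hI
    have hρ' := hτ2.congr fun r hr => hρ r (by omega)
    have h13 : (execBlock (.numLoad 4 1 6 12 :: transfer 6 12) ρ).flow =
        ρ.flow.push s j (ρ.flow.res s j) := by
      rw [execBlock, flow_execBlock_transfer (σ := (RAMInstr.numLoad 4 1 6 12).exec ρ) hρ'.zero]
      simp [RAMInstr.exec, RAMStore.flow, hρ'.source, hρj]
    refine ⟨fun r hr => rfl, ?_⟩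
    rw [h13]
    have h14 := h10.nonneg s hs j hj
    refine ⟨h7, h8, h9, h10.push hs hj h14 le_rfl, fun p hp hps => ?_, fun q hq hqs => ?_⟩
    · have := h11 p hp hps
      simp only [FlowMem.push, pushExc, hps, if_false]
      split_ifs <;> linarith
    · by_cases hqj : q = j
      · subst hqj
        simp [FlowMem.push, pushRes, hqs]
      · simp [FlowMem.push, pushRes, hqs, hqj, h12 q (by omega) hqs]
  · obtain ⟨h7, h8, h9, h10, h11, h12, h13⟩ := h
    refine ⟨fun r hr => by rw [h7 r (by omega), h5, h1 r (by omega)], h8, h11, h12, h9,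
      h10 t ht hst.symm, fun v hv => ?_, fun u hu v hv huv => ?_⟩
    · by_cases hvs : v = s
      · rw [hvs, h9]; exact Nat.zero_le _
      · rw [h10 v hv hvs]
    · by_cases hvs : v = s
      · rw [hvs, h9]; exact Nat.zero_le _
      · by_cases hus : u = s
        · rw [hus, h13 v hv hvs] at huv
          exact absurd huv (lt_irrefl _)
        · rw [h10 v hv hvs, h10 u hu hus]; omega

/-! ### Minimising over the choices of `y`. -/

/-- Updating the value of the best cut. -/
def updateBest : RAMProgram :=
  seq (block [.numLoad 2 2 7 3, .idxLoad 13 2 3 3])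
    (ite (.idxLt 3 13) (ite (.numLt 2 0) (instr (.numCopy 0 2)) skip)
      (block [.numCopy 0 2, .idxStore 2 3 3 2]))

theorem within_updateBest {σ : RAMStore} {N s t : ℕ} (hσ : FlowRegs σ N s t) :
    updateBest.Within σ 5 fun τ =>
      (∀ r < 8, τ.idx r = σ.idx r) ∧ τ.flow.ctx.weight = σ.flow.ctx.weight ∧
      τ.flow.ctx.zero = σ.flow.ctx.zero ∧ 0 < τ.flow.ctx.flag ∧
      τ.flow.ctx.best = if 0 < σ.flow.ctx.flag then min σ.flow.ctx.best (σ.flow.exc t)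
        else σ.flow.exc t := by
  refine Within.seq (T := 2) (T' := 3) (within_block (by simp) ?_)
  set σ₁ := execBlock [.numLoad 2 2 7 3, .idxLoad 13 2 3 3] σ with hσ₁
  have hf : ∀ r < 8, σ₁.idx r = σ.idx r := by
    intro r hr
    have h13 : r ≠ 13 := by omega
    simp [hσ₁, execBlock, RAMInstr.exec, h13]
  have hm : σ₁.flow = σ.flow := rfl
  have h13 : σ₁.idx 13 = σ.flow.ctx.flag := by
    simp [hσ₁, execBlock, RAMInstr.exec, RAMStore.flow, hσ.zero]
  have hn2 : σ₁.num 2 = σ.flow.exc t := by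
    simp [hσ₁, execBlock, RAMInstr.exec, RAMStore.flow, hσ.zero, hσ.sink]
  have hn0 : σ₁.num 0 = σ.flow.ctx.best := rfl
  have hσ₁' := hσ.congr hf
  clear_value σ₁
  refine within_ite (T := 2) (fun h => within_ite (T := 1) (fun h' => within_instr ?_)
    fun h' => within_skip ?_) fun h => within_block (by simp) ?_
  · change σ₁.idx 3 < σ₁.idx 13 at h
    change σ₁.num 2 < σ₁.num 0 at h'
    rw [hσ₁'.zero, h13] at h
    refine ⟨hf, hm ▸ rfl, hm ▸ rfl, ?_, ?_⟩
    · rw [← hm] at h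
      exact h
    · rw [hn2, hn0] at h'
      rw [if_pos h, min_eq_right h'.le, ← hn2]
      simp [RAMInstr.exec, RAMStore.flow]
  · change σ₁.idx 3 < σ₁.idx 13 at h
    change ¬ σ₁.num 2 < σ₁.num 0 at h'
    rw [hσ₁'.zero, h13] at h
    rw [hn2, hn0, not_lt] at h'
    rw [hm, if_pos h, min_eq_left h']
    exact ⟨hf, rfl, rfl, h, rfl⟩
  · change ¬ σ₁.idx 3 < σ₁.idx 13 at h
    rw [hσ₁'.zero, h13] at h
    refine ⟨hf, hm ▸ rfl, hm ▸ rfl, ?_, ?_⟩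
    · simp [execBlock, RAMInstr.exec, RAMStore.flow, hσ₁'.zero, hσ₁'.one]
    · rw [if_neg h, ← hn2]
      simp [execBlock, RAMInstr.exec, RAMStore.flow]

/-- The minimum of the minimum cuts over the networks that `build` constructs for the values other
than `idx[1]` of `idx[5]`. -/
def bestCut (setup : RAMInstr) (build : RAMProgram) : RAMProgram :=
  seq (block [.idxConst 2 1, setup])
    (forLoop 5 3 0 (ifEq 5 1 skip (seq build (seq initFlow (seq pushRelabel updateBest)))))

/-- `build` constructs the network with `N` nodes, source `s`, sink `t y` and capacities `c y`
for `y = idx[5]`, from the weights `W`, within `T` steps. -/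
def Builds (build : RAMProgram) (n x : ℕ) (W : ℕ → ℕ → ℝ) (N s : ℕ) (t : ℕ → ℕ)
    (c : ℕ → ℕ → ℕ → ℝ) (T : ℕ) : Prop :=
  ∀ (σ : RAMStore) (y : ℕ), σ.idx 0 = n → σ.idx 1 = x → σ.idx 2 = 1 → σ.idx 3 = 0 → σ.idx 4 = N →
    σ.idx 5 = y → σ.flow.ctx.weight = W → σ.flow.ctx.zero = 0 → build.Within σ T fun τ =>
      (∀ r ≤ 5, τ.idx r = σ.idx r) ∧ τ.idx 6 = s ∧ τ.idx 7 = t y ∧ τ.flow.ctx = σ.flow.ctx ∧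
      ∀ u < N, ∀ v < N, τ.flow.res u v = c y u v

/-- The running time of `bestCut`. -/
def bestCutTime (n N T : ℕ) : ℕ :=
  2 + forTime n (T + (initFlowTime N + (pushRelabelTime N + 5)) + 2)

theorem within_bestCut {setup : RAMInstr} {build : RAMProgram} {n x N s T : ℕ}
    {W : ℕ → ℕ → ℝ} {t : ℕ → ℕ} {c : ℕ → ℕ → ℕ → ℝ} {σ : RAMStore} (hn : 2 ≤ n)
    (hσ0 : σ.idx 0 = n) (hσ1 : σ.idx 1 = x) (hσ3 : σ.idx 3 = 0)
    (hW : σ.flow.ctx.weight = W) (hz : σ.flow.ctx.zero = 0) (hflag : σ.flow.ctx.flag = 0)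
    (hsetup : ∀ τ : RAMStore, τ.idx 0 = n →
      setup.exec τ = { τ with idx := Function.update τ.idx 4 N })
    (hb : Builds build n x W N s t c T) (hs : s < N) (ht : ∀ y < n, y ≠ x → t y < N)
    (hst : ∀ y < n, y ≠ x → s ≠ t y) (hc : ∀ y < n, ∀ u < N, ∀ v < N, 0 ≤ c y u v) :
    (bestCut setup build).Within σ (bestCutTime n N T) fun τ =>
      IsLeast {z | ∃ y < n, y ≠ x ∧ z ∈ cutValues N (c y) s (t y)} (τ.num 0) := by
  refine Within.seq (T := 2) (within_block (by simp) ?_)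
  have hex : execBlock [.idxConst 2 1, setup] σ =
      { σ with idx := Function.update (Function.update σ.idx 2 1) 4 N } := by
    rw [execBlock, execBlock, execBlock, hsetup _ (by simp [RAMInstr.exec, hσ0])]
    rfl
  rw [hex]
  set σ₁ : RAMStore := { σ with idx := Function.update (Function.update σ.idx 2 1) 4 N } with hσ₁
  have h0 : σ₁.idx 0 = n := by simp [hσ₁, hσ0]
  have h1 : σ₁.idx 1 = x := by simp [hσ₁, hσ1]
  have h2 : σ₁.idx 2 = 1 := by simp [hσ₁]
  have h3 : σ₁.idx 3 = 0 := by simp [hσ₁, hσ3]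
  have h4 : σ₁.idx 4 = N := by simp [hσ₁]
  have hm : σ₁.flow = σ.flow := rfl
  clear_value σ₁
  -- No number stands for infinity, so the flag records whether `best` is meaningful yet.
  refine (within_forLoop (fun j m => m.ctx.weight = W ∧ m.ctx.zero = 0 ∧
    if 0 < m.ctx.flag then
      IsLeast {z | ∃ y < j, y ≠ x ∧ z ∈ cutValues N (c y) s (t y)} m.ctx.best
    else ∀ y < j, y = x) (by norm_num) (by norm_num) h2 h3 h0 (Nat.zero_le _) ?_
    fun y hy _ τ hτ hτy hI => within_ifEq (fun hyx => ?_) fun hyx => ?_).mono le_rfl fun τ h => ?_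
  · rw [hm]
    refine ⟨hW, hz, ?_⟩
    rw [hflag, if_neg (lt_irrefl 0)]
    exact fun y hy => absurd hy (Nat.not_lt_zero y)
  · rw [hτy, hτ 1 (by norm_num), h1] at hyx
    subst hyx
    refine within_skip ⟨fun r _ => rfl, hI.1, hI.2.1, ?_⟩
    have h5 := hI.2.2
    split_ifs at h5 ⊢ with h6
    · convert h5 using 1
      ext z
      constructor
      · rintro ⟨z', h7, h8, h9⟩
        exact ⟨z', by omega, h8, h9⟩
      · rintro ⟨z', h7, h8, h9⟩
        exact ⟨z', by omega, h8, h9⟩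
    · intro z hz
      rcases Nat.lt_succ_iff_lt_or_eq.1 hz with h7 | h7
      · exact h5 z h7
      · exact h7
  · rw [hτy, hτ 1 (by norm_num), h1] at hyx
    obtain ⟨h5, h6, h7⟩ := hI
    refine Within.seq ((hb τ y (by rw [hτ 0 (by norm_num), h0]) (by rw [hτ 1 (by norm_num), h1])
      (by rw [hτ 2 (by norm_num), h2]) (by rw [hτ 3 (by norm_num), h3])
      (by rw [hτ 4 (by norm_num), h4]) hτy h5 h6).mono le_rfl fun ρ h => ?_)
    obtain ⟨h8, h9, h10, h11, h12⟩ := h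
    have hρ : FlowRegs ρ N s (t y) := ⟨by rw [h8 2 (by norm_num), hτ 2 (by norm_num), h2],
      by rw [h8 3 (by norm_num), hτ 3 (by norm_num), h3],
      by rw [h8 4 (by norm_num), hτ 4 (by norm_num), h4], h9, h10⟩
    refine Within.seq ((within_initFlow hρ hs (ht y hy hyx) (hst y hy hyx) (by rw [h11, h6])
      (hc y hy) h12).mono le_rfl fun π h => ?_)
    obtain ⟨h13, h14, h15⟩ := h
    have hπ := hρ.congr h13
    refine Within.seq ((within_pushRelabel hπ hs (ht y hy hyx) (hst y hy hyx)
      (by rw [h14, h11, h6]) h15).mono le_rfl fun α h => ?_)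
    obtain ⟨h16, h17, h18⟩ := h
    have hα := hπ.congr h16
    refine (within_updateBest hα).mono le_rfl fun β h => ?_
    obtain ⟨h19, h20, h21, h22, h23⟩ := h
    have hctx : α.flow.ctx = τ.flow.ctx := h17.trans (h14.trans h11)
    refine ⟨fun r hr => by rw [h19 r (by omega), h16 r (by omega), h13 r (by omega), h8 r hr],
      by rw [h20, hctx, h5], by rw [h21, hctx, h6], ?_⟩
    rw [if_pos h22, h23, hctx]
    have h24 : {z | ∃ z' < y + 1, z' ≠ x ∧ z ∈ cutValues N (c z') s (t z')} =
        {z | ∃ z' < y, z' ≠ x ∧ z ∈ cutValues N (c z') s (t z')} ∪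
          cutValues N (c y) s (t y) := by
      ext z
      constructor
      · rintro ⟨z', h25, h26, h27⟩
        rcases Nat.lt_succ_iff_lt_or_eq.1 h25 with h28 | rfl
        · exact Or.inl ⟨z', h28, h26, h27⟩
        · exact Or.inr h27
      · rintro (⟨z', h25, h26, h27⟩ | h27)
        · exact ⟨z', by omega, h26, h27⟩
        · exact ⟨y, by omega, hyx, h27⟩
    rw [h24]
    split_ifs at h7 ⊢ with h25
    · exact h7.union h18
    · convert h18
      rw [Set.union_eq_right]
      rintro z ⟨z', h26, h27, -⟩
      exact absurd (h7 z' h26) h27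
  · obtain ⟨h5, h6, h7, h8⟩ := h
    split_ifs at h8 with h9
    · exact h8
    · have h10 := h8 0 (by omega)
      have h11 := h8 1 (by omega)
      omega

end RAMProgram

/-! ### Reversal sets and cuts. -/

namespace Tournament

variable {V : Type*} {T : Tournament V}

open Classical in
/-- The weight of the edge from `a` to `b`, or `0` if there is none. -/
noncomputable def weight (T : Tournament V) (w : T.Edge → ℝ) (a b : V) : ℝ :=
  if h : T.Adj a b then w ⟨(a, b), h⟩ else 0

theorem weight_nonneg {w : T.Edge → ℝ} (hw : ∀ e, 0 < w e) (a b : V) : 0 ≤ T.weight w a b := by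
  unfold weight
  split_ifs
  · exact (hw _).le
  · exact le_rfl

theorem weight_of_not_adj {w : T.Edge → ℝ} {a b : V} (h : ¬ T.Adj a b) : T.weight w a b = 0 :=
  dif_neg h

open Classical in
/-- The set of the edges of `T` that are related by `Q`. -/
noncomputable def edgesWith [Fintype V] (T : Tournament V) (Q : V → V → Prop) : Finset T.Edge :=
  Finset.univ.filter fun e => Q e.1.1 e.1.2

theorem mem_edgesWith [Fintype V] {Q : V → V → Prop} {e : T.Edge} :
    e ∈ T.edgesWith Q ↔ Q e.1.1 e.1.2 := by
  simp [edgesWith]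

theorem reverse_edgesWith_adj [Fintype V] {Q : V → V → Prop} {a b : V} :
    (T.reverse (T.edgesWith Q)).Adj a b ↔ T.Adj a b ∧ ¬ Q a b ∨ T.Adj b a ∧ Q b a := by
  simp [reverse, mem_edgesWith]

/-- Weights vanish off the edges, so a cost becomes a sum over all ordered pairs and can be compared
with `cutValue` term by term. -/
theorem cost_eq_sum [Fintype V] (w : T.Edge → ℝ) {R : Finset T.Edge} {Q : V → V → Prop}
    [DecidableRel Q] (h : ∀ e : T.Edge, e ∈ R ↔ Q e.1.1 e.1.2) :
    T.cost w R = ∑ a, ∑ b, if Q a b then T.weight w a b else 0 := by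
  classical
  have h1 : T.cost w R = ∑ p ∈ R.map (Function.Embedding.subtype _), T.weight w p.1 p.2 := by
    rw [Finset.sum_map]
    refine Finset.sum_congr rfl fun e _ => ?_
    change w e = T.weight w e.1.1 e.1.2
    rw [weight, dif_pos e.2]
  rw [h1, ← Fintype.sum_prod_type', ← Finset.sum_filter]
  refine Finset.sum_subset_zero_on_sdiff (fun p hp => ?_) (fun p hp => ?_) fun _ _ => rfl
  · obtain ⟨e, he, rfl⟩ := Finset.mem_map.1 hp
    exact Finset.mem_filter.2 ⟨Finset.mem_univ _, (h e).1 he⟩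
  · obtain ⟨h2, h3⟩ := Finset.mem_sdiff.1 hp
    refine weight_of_not_adj fun h4 => h3 (Finset.mem_map.2 ⟨⟨p, h4⟩, (h _).2 ?_, rfl⟩)
    exact (Finset.mem_filter.1 h2).2

open Classical in
theorem cost_edgesWith [Fintype V] (w : T.Edge → ℝ) (Q : V → V → Prop) :
    T.cost w (T.edgesWith Q) = ∑ a, ∑ b, if Q a b then T.weight w a b else 0 :=
  cost_eq_sum w fun _ => mem_edgesWith

-- An edge of `T` lies in `R` exactly when it is no longer an edge of the reversed tournament. The
-- lower bounds therefore need to know only the latter, not `R`.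
open Classical in
theorem cost_eq_sum_not_adj [Fintype V] (w : T.Edge → ℝ) (R : Finset T.Edge) :
    T.cost w R = ∑ a, ∑ b, if ¬ (T.reverse R).Adj a b then T.weight w a b else 0 := by
  refine cost_eq_sum w ?_
  rintro ⟨⟨a, b⟩, h⟩
  have h' := T.asymm a b h
  simp [reverse, h, h']

/-- If the minimum `v` of `K` is attained by reversal sets and `K` bounds their costs from below,
then `v` is the margin of victory. -/
theorem isMoV_of_isLeast {S : Tournament V → Set V} {w : T.Edge → ℝ} {x : V} {v : ℝ} {K : Set ℝ}
    (hx : x ∈ S T) (hv : IsLeast K v)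
    (h1 : ∀ z ∈ K, ∃ R, x ∉ S (T.reverse R) ∧ T.cost w R ≤ z)
    (h2 : ∀ R, x ∉ S (T.reverse R) → ∃ z ∈ K, z ≤ T.cost w R) : IsMoV S T w x v := by
  have h3 : ∀ R, x ∉ S (T.reverse R) → v ≤ T.cost w R := fun R hR => by
    obtain ⟨z, hz, hzR⟩ := h2 R hR
    exact (hv.2 hz).trans hzR
  obtain ⟨R, hR, hRv⟩ := h1 v hv.1
  refine Or.inl ⟨hx, ⟨R, ⟨hx, hR⟩, le_antisymm (h3 R hR) hRv⟩, ?_⟩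
  rintro _ ⟨R', hR', rfl⟩
  exact h3 R' hR'.2

/-! ### The top cycle -/

/-- Once all edges out of `C` are reversed, the complement of `C` is dominant and avoids `x`. -/
theorem notMem_topCycle_reverse [Fintype V] {C : Set V} {x y : V} (hx : x ∈ C) (hy : y ∉ C) :
    x ∉ (T.reverse (T.edgesWith fun a b => a ∈ C ∧ b ∉ C)).topCycle := by
  intro h
  refine h Cᶜ ⟨⟨y, hy⟩, fun a ha b hb => ?_⟩ hx
  rw [Set.mem_compl_iff] at ha
  rw [Set.mem_compl_iff, not_not] at hb
  rw [reverse_edgesWith_adj]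
  rcases T.connex a b (by rintro rfl; exact ha hb) with h1 | h1
  · exact Or.inl ⟨h1, fun h => ha h.1⟩
  · exact Or.inr ⟨h1, hb, ha⟩

theorem exists_of_notMem_topCycle {x : V} (hx : x ∉ T.topCycle) :
    ∃ y ≠ x, ∃ C : Set V, x ∈ C ∧ y ∉ C ∧ ∀ a ∈ C, ∀ b ∉ C, ¬ T.Adj a b := by
  simp only [topCycle, Set.mem_sInter, not_forall] at hx
  obtain ⟨B, ⟨⟨y, hy⟩, hB⟩, hxB⟩ := hx
  refine ⟨y, by rintro rfl; exact hxB hy, Bᶜ, hxB, not_not.2 hy, fun a ha b hb => ?_⟩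
  exact T.asymm b a (hB b (not_not.1 hb) a ha)

/-! ### The uncovered set -/

/-- Afterwards the out-neighbours of `x` all lie in `C`, and `y` beats everything in `C` (edges from
`y` into `C` are untouched). Hence `y` covers `x`. -/
theorem notMem_uncoveredSet_reverse [Fintype V] {C : Set V} {x y : V} (hx : x ∈ C) (hy : y ∉ C) :
    x ∉ (T.reverse (T.edgesWith fun a b => (a = x ∨ b = y) ∧ a ∈ C ∧ b ∉ C)).uncoveredSet := by
  intro h
  refine h y ⟨by rintro rfl; exact hy hx, fun z hz => ?_⟩
  simp only [dominion, Set.mem_ofPred_eq, reverse_edgesWith_adj] at hz ⊢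
  have hzC : z ∈ C := by
    rcases hz with ⟨-, hz⟩ | ⟨-, -, -, hz⟩
    · by_contra hzC
      exact hz ⟨Or.inl trivial, hx, hzC⟩
    · exact absurd hx hz
  rcases T.connex y z (by rintro rfl; exact hy hzC) with h1 | h1
  · exact Or.inl ⟨h1, fun h => hy h.2.1⟩
  · exact Or.inr ⟨h1, Or.inr trivial, hzC, hy⟩

theorem exists_of_notMem_uncoveredSet {x : V} (hx : x ∉ T.uncoveredSet) :
    ∃ y ≠ x, ∃ C : Set V, x ∈ C ∧ y ∉ C ∧
      ∀ a ∈ C, ∀ b ∉ C, (a = x ∨ b = y) → ¬ T.Adj a b := by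
  simp only [uncoveredSet, Set.mem_ofPred_eq, not_forall, not_not] at hx
  obtain ⟨y, hyx, hsub⟩ := hx
  have hxy : ¬ T.Adj x y := fun h => T.irrefl y (hsub h)
  -- The cut is `x` with its dominion: nothing else is beaten by `x`, and all of the dominion is
  -- beaten by the covering `y`.
  refine ⟨y, hyx, {a | a = x ∨ T.Adj x a}, Or.inl rfl, not_or.2 ⟨hyx, hxy⟩, ?_⟩
  rintro a ha b hb (rfl | rfl) h
  · exact hb (Or.inr h)
  · rcases ha with rfl | ha
    · exact hxy h
    · exact T.asymm a b h (hsub ha)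

/-! ### The 3-kings -/

theorem HasPath.of_le_three {m : ℕ} (hm : m ≤ 3) {x y : V} (hxy : x ≠ y) (h : T.HasPath m x y) :
    T.Adj x y ∨ (∃ z, T.Adj x z ∧ T.Adj z y) ∨ ∃ a b, T.Adj x a ∧ T.Adj a b ∧ T.Adj b y := by
  obtain ⟨p, -, h0, h1, h2⟩ := h
  interval_cases m
  · exact absurd (h0.symm.trans h1) hxy
  · left
    have := h2 0
    rwa [← h0, ← h1]
  · right; left
    rw [← h0, ← h1]
    exact ⟨p 1, h2 0, h2 1⟩
  · right; right
    rw [← h0, ← h1]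
    exact ⟨p 1, p 2, h2 0, h2 1, h2 2⟩

/-- Paths must be injective, but here walks are excluded. Excluding the edge from `x` to `y` first
makes the vertices of a longer walk distinct. -/
theorem exists_of_notMem_kings {x : V} (hx : x ∉ T.kings 3) :
    ∃ y ≠ x, ¬ T.Adj x y ∧ (∀ z, T.Adj x z → ¬ T.Adj z y) ∧
      ∀ a b, T.Adj x a → T.Adj a b → ¬ T.Adj b y := by
  simp only [kings, Set.mem_ofPred_eq, not_forall, not_exists, not_and] at hx
  obtain ⟨y, hyx, h⟩ := hx
  have hne : ∀ {a b}, T.Adj a b → a ≠ b := by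
    rintro a b h rfl
    exact T.irrefl a h
  have h1 : ¬ T.Adj x y := by
    refine fun h1 => h 1 (by norm_num) ⟨![x, y], ?_, rfl, rfl, ?_⟩
    · intro i j hij
      fin_cases i <;> fin_cases j <;> first | rfl | (simp at hij; grind)
    · intro i
      fin_cases i
      exact h1
  refine ⟨y, hyx, h1, fun z h2 h3 => h 2 (by norm_num) ⟨![x, z, y], ?_, rfl, rfl, ?_⟩,
    fun a b h2 h3 h4 => h 3 le_rfl ⟨![x, a, b, y], ?_, rfl, rfl, ?_⟩⟩
  · have h4 := hne h2
    have h5 := hne h3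
    intro i j hij
    fin_cases i <;> fin_cases j <;> first | rfl | (simp at hij; grind)
  · intro i
    fin_cases i
    · exact h2
    · exact h3
  · have h5 := hne h2
    have h6 := hne h3
    have h7 := hne h4
    -- A walk returning to `x` or reaching `y` early would contain the edge from `x` to `y`.
    have h8 : a ≠ y := by rintro rfl; exact h1 h2
    have h9 : b ≠ x := by rintro rfl; exact h1 h4
    intro i j hij
    fin_cases i <;> fin_cases j <;> first | rfl | (simp at hij; grind)
  · intro i
    fin_cases i
    · exact h2
    · exact h3
    · exact h4

/-- The edges to be reversed for a cut of the layered network: the cut contains the nodes `C₁` in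
the first layer and `C₂` in the second. -/
def kingsReversal (C₁ C₂ : Set V) (x y a b : V) : Prop :=
  a = x ∧ (b = y ∨ b ∉ C₁ ∨ b ∉ C₂) ∨ a ≠ x ∧ b = y ∧ a ∈ C₂ ∨
    (a ≠ x ∧ a ≠ y ∧ b ≠ x ∧ b ≠ y ∧ a ∈ C₁ ∧ b ∉ C₂)

/-- After the reversal, out-neighbours of `x` lie in both `C₁` and `C₂`, and in-neighbours of `y`
lie outside `C₂`; this rules out lengths 1 and 2. For length 3, an original middle edge from `C₁` to
the complement of `C₂` has been reversed, and a newly created middle edge starts outside `C₂`. The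
latter is why edges from `x` to nodes outside `C₂` are reversed as well. -/
theorem notMem_kings_reverse [Fintype V] {C₁ C₂ : Set V} {x y : V} (hyx : y ≠ x) :
    x ∉ (T.reverse (T.edgesWith (kingsReversal C₁ C₂ x y))).kings 3 := by
  intro h
  obtain ⟨m, hm, hp⟩ := h y hyx
  have hxb : ∀ b, (T.reverse (T.edgesWith (kingsReversal C₁ C₂ x y))).Adj x b →
      b ≠ x ∧ b ≠ y ∧ b ∈ C₁ ∧ b ∈ C₂ := by
    intro b hb
    have hbx : b ≠ x := by rintro rfl; exact Tournament.irrefl _ _ hb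
    rw [reverse_edgesWith_adj] at hb
    simp only [kingsReversal] at hb
    grind
  have hay : ∀ a, (T.reverse (T.edgesWith (kingsReversal C₁ C₂ x y))).Adj a y →
      a ≠ x ∧ a ≠ y ∧ a ∉ C₂ := by
    intro a ha
    have hax : a ≠ y := by rintro rfl; exact Tournament.irrefl _ _ ha
    rw [reverse_edgesWith_adj] at ha
    simp only [kingsReversal] at ha
    grind
  rcases hp.of_le_three hm hyx.symm with h1 | ⟨z, h1, h2⟩ | ⟨a, b, h1, h2, h3⟩
  · exact (hxb y h1).2.1 rfl
  · exact (hay z h2).2.2 (hxb z h1).2.2.2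
  · have h4 := hxb a h1
    have h5 := hay b h3
    rw [reverse_edgesWith_adj] at h2
    simp only [kingsReversal] at h2
    grind

end Tournament

/-! ### The layered network for 3-kings. -/

/-- The capacities from the first layer to itself in the network for 3-kings. -/
def kingsFst (x y : ℕ) (W : ℕ → ℕ → ℝ) (p q : ℕ) : ℝ := if p = x ∧ q ≠ y then W p q else 0

/-- The capacities from the first layer to the second in the network for 3-kings. -/
def kingsMid (x y : ℕ) (W : ℕ → ℕ → ℝ) (p q : ℕ) : ℝ :=
  if p = x then (if q = y then W p q else 0) else
    -- The diagonal arc carries the paths `x → p → y`. The first copy of `p` receives at most `W x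
    -- p`, so this capacity does the work of an infinite one.
    if q = y then 0 else if p = q then W x p else W p q

/-- The capacities from the second layer to itself in the network for 3-kings. -/
def kingsSnd (x y : ℕ) (W : ℕ → ℕ → ℝ) (p q : ℕ) : ℝ := if p ≠ x ∧ q = y then W p q else 0

/-- The capacities of the layered network whose cuts destroy the paths of length at most `3` from
`x` to `y`. -/
def kingsCap (n x y : ℕ) (W : ℕ → ℕ → ℝ) (p q : ℕ) : ℝ :=
  if p < n then if q < n then kingsFst x y W p q else kingsMid x y W p (q - n)
  else if q < n then 0 else kingsSnd x y W (p - n) (q - n)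

theorem kingsCap_nonneg {n x y : ℕ} {W : ℕ → ℕ → ℝ} (hW : ∀ p q, 0 ≤ W p q) (p q : ℕ) :
    0 ≤ kingsCap n x y W p q := by
  unfold kingsCap kingsFst kingsMid kingsSnd
  split_ifs <;> first | exact hW _ _ | exact le_rfl

open Classical in
theorem cutValue_kingsCap (n x y : ℕ) (W : ℕ → ℕ → ℝ) (C : Set ℕ) :
    cutValue (n + n) (kingsCap n x y W) C = ∑ a : Fin n, ∑ b : Fin n,
      ((if (a : ℕ) ∈ C ∧ (b : ℕ) ∉ C then kingsFst x y W a b else 0) +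
      (if (a : ℕ) ∈ C ∧ (n + b : ℕ) ∉ C then kingsMid x y W a b else 0) +
      (if (n + a : ℕ) ∈ C ∧ (n + b : ℕ) ∉ C then kingsSnd x y W a b else 0)) := by
  have h1 : ∀ a : Fin n, ∀ b : Fin n, kingsCap n x y W a b = kingsFst x y W a b := by
    intro a b
    simp [kingsCap]
  have h2 : ∀ a : Fin n, ∀ b : Fin n, kingsCap n x y W a (n + b) = kingsMid x y W a b := by
    intro a b
    simp [kingsCap]
  have h3 : ∀ a : Fin n, ∀ b : Fin n, kingsCap n x y W (n + a) b = 0 := by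
    intro a b
    simp [kingsCap]
  have h4 : ∀ a : Fin n, ∀ b : Fin n, kingsCap n x y W (n + a) (n + b) = kingsSnd x y W a b := by
    intro a b
    simp [kingsCap]
  simp only [cutValue, Finset.sum_range_add]
  simp only [Finset.sum_range, h1, h2, h3, h4, ite_self,
    Finset.sum_const_zero, zero_add, Finset.sum_add_distrib]

open Classical in
/-- A cut of the layered network gives a set of edges to be reversed that costs no more. -/
theorem sum_kingsReversal_le {n : ℕ} {x y : Fin n} (hyx : y ≠ x) {W : ℕ → ℕ → ℝ}
    (hW : ∀ p q, 0 ≤ W p q) (hW0 : ∀ p, W p p = 0) {C : Set ℕ} (hx : (x : ℕ) ∈ C)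
    (hy : n + (y : ℕ) ∉ C) :
    (∑ a : Fin n, ∑ b : Fin n,
      if Tournament.kingsReversal {a : Fin n | (a : ℕ) ∈ C} {a | n + (a : ℕ) ∈ C} x y a b then
        W a b else 0) ≤ cutValue (n + n) (kingsCap n x y W) C := by
  -- A cut diagonal arc at `b` pays for reversing the edge from `x` to `b`. Moving these terms from
  -- the diagonal to row `x` makes a termwise comparison possible.
  let D (b : Fin n) : ℝ := if b ≠ x ∧ b ≠ y ∧ (b : ℕ) ∈ C ∧ n + (b : ℕ) ∉ C then W x b else 0
  let G (a b : Fin n) : ℝ :=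
    (if (a : ℕ) ∈ C ∧ (b : ℕ) ∉ C then kingsFst x y W a b else 0) +
    (if (a : ℕ) ∈ C ∧ (n + b : ℕ) ∉ C then (if a = b then 0 else kingsMid x y W a b) else 0) +
    (if (n + a : ℕ) ∈ C ∧ (n + b : ℕ) ∉ C then kingsSnd x y W a b else 0)
  have hdiag : ∑ a : Fin n, ∑ b : Fin n, (if a = b then D b else 0) =
      ∑ a : Fin n, ∑ b : Fin n, (if a = x then D b else 0) := by
    rw [Finset.sum_comm]
    conv_rhs => rw [Finset.sum_comm]
    simp
  have hsplit : cutValue (n + n) (kingsCap n x y W) C =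
      ∑ a : Fin n, ∑ b : Fin n, (G a b + if a = x then D b else 0) := by
    simp only [Finset.sum_add_distrib]
    rw [← hdiag, cutValue_kingsCap]
    simp only [← Finset.sum_add_distrib]
    refine Finset.sum_congr rfl fun a _ => Finset.sum_congr rfl fun b _ => ?_
    by_cases hab : a = b
    · subst hab
      simp only [G, D, kingsMid, Fin.val_inj, if_true]
      by_cases h1 : a = x
      · have h2 : x ≠ y := hyx.symm
        simp [h1, h2]
      · by_cases h2 : a = y
        · simp [h2, hyx]
        · simp [h1, h2]
    · simp [G, hab]
  rw [hsplit]
  refine Finset.sum_le_sum fun a _ => Finset.sum_le_sum fun b _ => ?_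
  have hWab := hW a b
  have hWxb := hW x b
  simp only [G, D, kingsFst, kingsMid, kingsSnd, Tournament.kingsReversal, Fin.val_inj,
    Set.mem_ofPred_eq]
  by_cases h1 : a = x
  · subst h1
    by_cases h2 : b = y
    · subst h2
      simp [hx, hy, hyx.symm]
    · by_cases h3 : (b : ℕ) ∈ C <;> by_cases h4 : n + (b : ℕ) ∈ C <;> by_cases h5 : b = a <;>
        simp_all [Fin.val_inj]
  · by_cases h2 : b = y
    · subst h2
      by_cases h4 : n + (a : ℕ) ∈ C <;> simp [*, Fin.val_inj]
    · by_cases h5 : a = b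
      · subst h5
        simp [*]
      · simp only [h1, h2, h5, if_false, false_and, and_false, false_or, ne_eq,
          not_false_eq_true, true_and, ite_self, add_zero, zero_add]
        split_ifs <;> first | exact le_rfl | exact hWab | (exfalso; tauto)

/-- A reversal set that destroys all paths of length at most `3` contains a cut. -/
theorem exists_cutValue_kingsCap_le {n : ℕ} {x y : Fin n} (hyx : y ≠ x) {W : ℕ → ℕ → ℝ}
    (hW : ∀ p q, 0 ≤ W p q) {A : Fin n → Fin n → Prop} [DecidableRel A] (h1 : ¬ A x y)
    (h2 : ∀ z, A x z → ¬ A z y) (h3 : ∀ a b, A x a → A a b → ¬ A b y) (h0 : ∀ p, W p p = 0) :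
    ∃ z ∈ cutValues (n + n) (kingsCap n x y W) x (n + y),
      z ≤ ∑ a : Fin n, ∑ b : Fin n, if ¬ A a b then W a b else 0 := by
  classical
  -- First layer: `x` and what it still beats. Second layer: the nodes other than `y` that do not
  -- beat `y`. With no walk of length 2 left, no diagonal arc with `p ≠ x` and `p ≠ y` is cut; the
  -- other diagonal capacities are 0, so each cut arc of positive capacity costs one reversed edge.
  let C : Set ℕ := {p | (∃ a : Fin n, p = a ∧ (a = x ∨ A x a)) ∨
    ∃ b : Fin n, p = n + b ∧ b ≠ y ∧ ¬ A b y}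
  have hC1 : ∀ a : Fin n, (a : ℕ) ∈ C ↔ a = x ∨ A x a := by
    intro a
    constructor
    · rintro (⟨a', h, h'⟩ | ⟨b, h, -⟩)
      · rwa [Fin.ext h]
      · have := a.isLt
        omega
    · exact fun h => Or.inl ⟨a, rfl, h⟩
  have hC2 : ∀ b : Fin n, n + (b : ℕ) ∈ C ↔ b ≠ y ∧ ¬ A b y := by
    intro b
    constructor
    · rintro (⟨a, h, -⟩ | ⟨b', h, h'⟩)
      · have := a.isLt
        omega
      · rwa [Fin.ext (Nat.add_left_cancel h)]
    · exact fun h => Or.inr ⟨b, rfl, h⟩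
  refine ⟨_, ⟨C, (hC1 x).2 (Or.inl rfl), fun h => ((hC2 y).1 h).1 rfl, rfl⟩, ?_⟩
  rw [cutValue_kingsCap]
  refine Finset.sum_le_sum fun a _ => Finset.sum_le_sum fun b _ => ?_
  have hWab := hW a b
  have hWaa := h0 a
  simp only [kingsFst, kingsMid, kingsSnd, Fin.val_inj, hC1, hC2]
  have h4 := h2 a
  have h5 := h3 a b
  by_cases hax : a = x
  · subst hax
    by_cases hby : b = y
    · subst hby
      simp [h1]
    · by_cases hAb : A a b
      · simp [hby, hAb]
      · by_cases hba : b = a <;> simp [hby, hAb, hba, hyx.symm, h1, h0, Fin.val_inj]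
  · by_cases hby : b = y
    · subst hby
      by_cases hab : a = b
      · simp [hab, h0]
      · by_cases hAa : A a b <;> simp [hax, hab, hAa, Fin.val_inj]
    · by_cases hab : a = b
      · subst hab
        by_cases hxa : A x a
        · simp [hax, hby, h4 hxa, hWaa]
        · simp [hax, hxa, hWaa]
      · simp only [hax, hby, hab, if_false, false_and, and_false, false_or, ne_eq,
          not_false_eq_true, true_and, ite_self, add_zero, zero_add]
        split_ifs <;> first | exact le_rfl | exact hWab | (exfalso; tauto)

/-! ### Programs that build the networks. -/

namespace RAMProgram

/-- The property `Pr` is attached to a pair of indices rather than to a matrix cell, because for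
3-kings one iteration fills four cells, one in each block. The body must preserve what other pairs
have established. -/
theorem within_fill {breg B N s t T : ℕ} {body : RAMProgram} {σ : RAMStore}
    (Pr : ℕ → ℕ → FlowMem → Prop) (hbreg : breg < 11) (hB : σ.idx breg = B)
    (hσ : FlowRegs σ N s t)
    (hbody : ∀ u < B, ∀ v < B, ∀ τ : RAMStore, (∀ r < 11, τ.idx r = σ.idx r) → τ.idx 11 = u →
      τ.idx 12 = v → τ.flow.ctx = σ.flow.ctx → body.Within τ T fun τ' =>
        (∀ r ≤ 12, τ'.idx r = τ.idx r) ∧ τ'.flow.ctx = τ.flow.ctx ∧ Pr u v τ'.flow ∧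
        ∀ a < B, ∀ b < B, ¬ (a = u ∧ b = v) → Pr a b τ.flow → Pr a b τ'.flow) :
    (forLoop 11 3 breg (forLoop 12 3 breg body)).Within σ (forTime B (forTime B T)) fun τ =>
      (∀ r < 11, τ.idx r = σ.idx r) ∧ τ.flow.ctx = σ.flow.ctx ∧
      ∀ a < B, ∀ b < B, Pr a b τ.flow := by
  let Inv (u v : ℕ) (m : FlowMem) : Prop := m.ctx = σ.flow.ctx ∧
    ∀ a < B, ∀ b < B, (a < u ∨ a = u ∧ b < v) → Pr a b m
  refine (within_forLoop (fun u => Inv u 0) (by norm_num) hbreg hσ.one hσ.zero hB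
    (Nat.zero_le _) ⟨rfl, fun a _ b _ h => by omega⟩ fun u hu _ τ hτ hτu hI => ?_).mono le_rfl
    fun τ h => ⟨h.1, h.2.1, fun a ha b hb => h.2.2 a ha b hb (Or.inl ha)⟩
  have hτ' := hσ.congr fun r hr => hτ r (by omega)
  refine (within_forLoop (fun v => Inv u v) (by norm_num) (by omega) hτ'.one hτ'.zero
    ((hτ breg hbreg).trans hB) (Nat.zero_le _) hI fun v hv _ ρ hρ hρv hI => ?_).mono le_rfl
    fun τ h => ⟨fun r hr => h.1 r (by omega), h.2.1, fun a ha b hb h' =>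
      h.2.2 a ha b hb (by omega)⟩
  refine (hbody u hu v hv ρ (fun r hr => (hρ r (by omega)).trans (hτ r hr))
    ((hρ 11 (by norm_num)).trans hτu) hρv hI.1).mono le_rfl fun α h => ?_
  obtain ⟨h1, h2, h3, h4⟩ := h
  refine ⟨h1, h2.trans hI.1, fun a ha b hb h => ?_⟩
  by_cases hab : a = u ∧ b = v
  · rw [hab.1, hab.2]; exact h3
  · exact h4 a ha b hb hab (hI.2 a ha b hb (by omega))

/-- The source and the sink are `idx[1]` and `idx[5]`, and `body` sets the residual capacity of
the arc `(idx[11], idx[12])`. -/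
def buildArcs (body : RAMProgram) : RAMProgram :=
  seq (block [.idxCopy 6 1, .idxCopy 7 5]) (forLoop 11 3 4 (forLoop 12 3 4 body))

theorem builds_buildArcs {body : RAMProgram} {n x T : ℕ} {W : ℕ → ℕ → ℝ} {c : ℕ → ℕ → ℕ → ℝ}
    (h : ∀ (σ : RAMStore) (y u v : ℕ), σ.idx 1 = x → σ.idx 5 = y → σ.idx 11 = u → σ.idx 12 = v →
      σ.flow.ctx.weight = W → σ.flow.ctx.zero = 0 → body.Within σ T fun τ => τ.idx = σ.idx ∧
        τ.flow.ctx = σ.flow.ctx ∧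
        ∀ a b, τ.flow.res a b = if a = u ∧ b = v then c y u v else σ.flow.res a b) :
    Builds (buildArcs body) n x W n x id c (2 + forTime n (forTime n T)) := by
  intro σ y h0 h1 h2 h3 h4 h5 hW hz
  refine Within.seq (T := 2) (within_block (by simp) ?_)
  set σ₁ := execBlock [.idxCopy 6 1, .idxCopy 7 5] σ with hσ₁
  have hf : ∀ r ≤ 5, σ₁.idx r = σ.idx r := by
    intro r hr
    have h6 : r ≠ 6 := by omega
    have h7 : r ≠ 7 := by omega
    simp [hσ₁, execBlock, RAMInstr.exec, h6, h7]
  have h6 : σ₁.idx 6 = x := by simp [hσ₁, execBlock, RAMInstr.exec, h1]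
  have h7 : σ₁.idx 7 = y := by simp [hσ₁, execBlock, RAMInstr.exec, h5]
  have hm : σ₁.flow = σ.flow := rfl
  clear_value σ₁
  have hR : FlowRegs σ₁ n x y := ⟨by rw [hf 2 (by norm_num), h2], by rw [hf 3 (by norm_num), h3],
    by rw [hf 4 (by norm_num), h4], h6, h7⟩
  refine (within_fill (fun a b m => m.res a b = c y a b) (by norm_num) hR.size hR
    fun u hu v hv τ hτ hu' hv' hctx => ?_).mono le_rfl fun τ h => ?_
  · refine (h τ y u v (by rw [hτ 1 (by norm_num), hf 1 (by norm_num), h1])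
      (by rw [hτ 5 (by norm_num), hf 5 (by norm_num), h5]) hu' hv' (by rw [hctx, hm, hW])
      (by rw [hctx, hm, hz])).mono le_rfl fun ρ h => ?_
    obtain ⟨h8, h9, h10⟩ := h
    refine ⟨fun r _ => by rw [h8], h9, by rw [h10]; simp, fun a _ b _ hab h11 => ?_⟩
    rw [h10, if_neg hab, h11]
  · obtain ⟨h8, h9, h10⟩ := h
    exact ⟨fun r hr => by rw [h8 r (by omega), hf r hr], by rw [h8 6 (by norm_num), h6],
      by rw [h8 7 (by norm_num), h7]; rfl, by rw [h9, hm], h10⟩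

/-- The network for the top cycle has all arcs. -/
def topCycleArc : RAMProgram := block [.numLoad 2 0 11 12, .numStore 1 11 12 2]

theorem flow_topCycleArc {σ : RAMStore} {T : ℕ} (hT : 2 ≤ T) :
    topCycleArc.Within σ T fun τ => τ.idx = σ.idx ∧ τ.flow.ctx = σ.flow.ctx ∧
      ∀ a b, τ.flow.res a b = if a = σ.idx 11 ∧ b = σ.idx 12 then
        σ.flow.ctx.weight (σ.idx 11) (σ.idx 12) else σ.flow.res a b := by
  refine within_block hT ⟨rfl, rfl, fun a b => ?_⟩
  simp [execBlock, RAMInstr.exec, RAMStore.flow]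

theorem builds_topCycle (n x : ℕ) (W : ℕ → ℕ → ℝ) :
    Builds (buildArcs topCycleArc) n x W n x id (fun _ => W)
      (2 + forTime n (forTime n 2)) := by
  refine builds_buildArcs fun σ y u v _ _ hu hv hW _ => ?_
  have := flow_topCycleArc (σ := σ) (le_refl 2)
  rwa [hu, hv, hW] at this

/-- The network for the uncovered set has the arcs that leave the source or enter the sink. -/
def uncoveredSetArc : RAMProgram :=
  ifEq 11 1 topCycleArc (ifEq 12 5 topCycleArc (instr (.numStore 1 11 12 1)))

theorem builds_uncoveredSet (n x : ℕ) (W : ℕ → ℕ → ℝ) :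
    Builds (buildArcs uncoveredSetArc) n x W n x id
      (fun y u v => if u = x ∨ v = y then W u v else 0) (2 + forTime n (forTime n 6)) := by
  refine builds_buildArcs fun σ y u v hx hy hu hv hW hz => ?_
  refine within_ifEq (T := 4) (fun h => ?_) fun h => within_ifEq (T := 2) (fun h' => ?_)
    fun h' => (within_instr ?_).mono one_le_two fun _ h => h
  · have := flow_topCycleArc (σ := σ) (T := 4) (by norm_num)
    rw [hu, hx] at h
    rw [hu, hv, hW] at this
    simpa [h] using this
  · have := flow_topCycleArc (σ := σ) (le_refl 2)
    rw [hv, hy] at h'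
    rw [hu, hv, hW] at this
    simpa [h'] using this
  · rw [hu, hx] at h
    rw [hv, hy] at h'
    refine ⟨rfl, rfl, fun a b => ?_⟩
    have hz' : σ.num 1 = 0 := hz
    simp [RAMInstr.exec, RAMStore.flow, hu, hv, h, h', hz']

/-- The layered network for 3-kings. -/
def kingsBuild : RAMProgram :=
  seq (block [.idxCopy 6 1, .idxAdd 7 0 5]) (forLoop 11 3 0 (forLoop 12 3 0
    (seq (block [.idxAdd 13 0 11, .idxAdd 14 0 12, .numLoad 2 0 11 12, .numCopy 3 1,
        .numCopy 4 1, .numCopy 5 1])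
      (seq (ifEq 11 1
          (ifEq 12 5 (instr (.numCopy 4 2)) (instr (.numCopy 3 2)))
          (ifEq 12 5 (instr (.numCopy 5 2))
            (ifEq 11 12 (instr (.numLoad 4 0 1 11)) (instr (.numCopy 4 2)))))
        (block [.numStore 1 11 12 3, .numStore 1 11 14 4, .numStore 1 13 12 1,
          .numStore 1 13 14 5])))))

theorem builds_kings (n x : ℕ) (W : ℕ → ℕ → ℝ) :
    Builds kingsBuild n x W (n + n) x (fun y => n + y) (fun y => kingsCap n x y W)
      (2 + forTime n (forTime n 17)) := by
  intro σ y h0 h1 h2 h3 h4 h5 hW hz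
  refine Within.seq (T := 2) (within_block (by simp) ?_)
  set σ₁ := execBlock [.idxCopy 6 1, .idxAdd 7 0 5] σ with hσ₁
  have hf : ∀ r ≤ 5, σ₁.idx r = σ.idx r := by
    intro r hr
    have h6 : r ≠ 6 := by omega
    have h7 : r ≠ 7 := by omega
    simp [hσ₁, execBlock, RAMInstr.exec, h6, h7]
  have h6 : σ₁.idx 6 = x := by simp [hσ₁, execBlock, RAMInstr.exec, h1]
  have h7 : σ₁.idx 7 = n + y := by simp [hσ₁, execBlock, RAMInstr.exec, h5, h0]
  have hm : σ₁.flow = σ.flow := rfl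
  clear_value σ₁
  have hR : FlowRegs σ₁ (n + n) x (n + y) := ⟨by rw [hf 2 (by norm_num), h2],
    by rw [hf 3 (by norm_num), h3], by rw [hf 4 (by norm_num), h4], h6, h7⟩
  refine (within_fill (fun a b m => m.res a b = kingsFst x y W a b ∧
    m.res a (n + b) = kingsMid x y W a b ∧ m.res (n + a) b = 0 ∧
    m.res (n + a) (n + b) = kingsSnd x y W a b) (by norm_num)
    (by rw [hf 0 (by norm_num), h0]) hR
    fun u hu v hv τ hτ hu' hv' hctx => ?_).mono le_rfl fun τ h => ?_
  · have g0 : τ.idx 0 = n := by rw [hτ 0 (by norm_num), hf 0 (by norm_num), h0]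
    have g1 : τ.idx 1 = x := by rw [hτ 1 (by norm_num), hf 1 (by norm_num), h1]
    have g5 : τ.idx 5 = y := by rw [hτ 5 (by norm_num), hf 5 (by norm_num), h5]
    have gW : τ.numArr 0 = W := by
      change τ.flow.ctx.weight = W
      rw [hctx, hm, hW]
    have gz : τ.num 1 = 0 := by
      change τ.flow.ctx.zero = 0
      rw [hctx, hm, hz]
    refine Within.seq (T := 6) (T' := 11) (within_block (by simp) ?_)
    set τ₁ := execBlock [.idxAdd 13 0 11, .idxAdd 14 0 12, .numLoad 2 0 11 12, .numCopy 3 1,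
        .numCopy 4 1, .numCopy 5 1] τ with hτ₁
    have kf : ∀ r ≤ 12, τ₁.idx r = τ.idx r := by
      intro r hr
      have h13 : r ≠ 13 := by omega
      have h14 : r ≠ 14 := by omega
      simp [hτ₁, execBlock, RAMInstr.exec, h13, h14]
    have k13 : τ₁.idx 13 = n + u := by simp [hτ₁, execBlock, RAMInstr.exec, g0, hu']
    have k14 : τ₁.idx 14 = n + v := by simp [hτ₁, execBlock, RAMInstr.exec, g0, hv']
    have k2 : τ₁.num 2 = W u v := by simp [hτ₁, execBlock, RAMInstr.exec, gW, hu', hv']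
    have k3 : τ₁.num 3 = 0 := by simp [hτ₁, execBlock, RAMInstr.exec, gz]
    have k4 : τ₁.num 4 = 0 := by simp [hτ₁, execBlock, RAMInstr.exec, gz]
    have k5 : τ₁.num 5 = 0 := by simp [hτ₁, execBlock, RAMInstr.exec, gz]
    have k1 : τ₁.num 1 = 0 := by simp [hτ₁, execBlock, RAMInstr.exec, gz]
    have kflow : τ₁.flow = τ.flow := rfl
    have kW : τ₁.numArr 0 = W := gW
    clear_value τ₁
    -- The four stores are common to all branches, which only have to place the right values in
    -- number registers 3, 4 and 5.
    have key : ∀ ρ : RAMStore, ρ.idx = τ₁.idx → ρ.flow = τ₁.flow →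
        ρ.num 3 = kingsFst x y W u v → ρ.num 4 = kingsMid x y W u v →
        ρ.num 5 = kingsSnd x y W u v → ρ.num 1 = 0 →
        (block [.numStore 1 11 12 3, .numStore 1 11 14 4, .numStore 1 13 12 1,
          .numStore 1 13 14 5]).Within ρ 4 fun τ' =>
        (∀ r ≤ 12, τ'.idx r = τ.idx r) ∧ τ'.flow.ctx = τ.flow.ctx ∧
        (τ'.flow.res u v = kingsFst x y W u v ∧ τ'.flow.res u (n + v) = kingsMid x y W u v ∧
          τ'.flow.res (n + u) v = 0 ∧ τ'.flow.res (n + u) (n + v) = kingsSnd x y W u v) ∧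
        ∀ a < n, ∀ b < n, ¬ (a = u ∧ b = v) →
          (τ.flow.res a b = kingsFst x y W a b ∧ τ.flow.res a (n + b) = kingsMid x y W a b ∧
          τ.flow.res (n + a) b = 0 ∧ τ.flow.res (n + a) (n + b) = kingsSnd x y W a b) →
          (τ'.flow.res a b = kingsFst x y W a b ∧ τ'.flow.res a (n + b) = kingsMid x y W a b ∧
          τ'.flow.res (n + a) b = 0 ∧ τ'.flow.res (n + a) (n + b) = kingsSnd x y W a b) := by
      intro ρ l0 l1 l3 l4 l5 l6
      have hres : ∀ p q, (execBlock [.numStore 1 11 12 3, .numStore 1 11 14 4,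
          .numStore 1 13 12 1, .numStore 1 13 14 5] ρ).flow.res p q =
          if p = n + u ∧ q = n + v then kingsSnd x y W u v else
          if p = n + u ∧ q = v then 0 else
          if p = u ∧ q = n + v then kingsMid x y W u v else
          if p = u ∧ q = v then kingsFst x y W u v else τ.flow.res p q := by
        intro p q
        rw [← kflow, ← l1]
        simp [execBlock, RAMInstr.exec, RAMStore.flow, l0, kf 11, kf 12, hu', hv', k13, k14, l3,
          l4, l5, l6]
      refine within_block (by simp) ⟨fun r hr => ?_, ?_, ?_, fun a ha b hb hab h => ?_⟩
      · rw [← kf r hr, ← l0]; rfl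
      · rw [← kflow, ← l1]; rfl
      · refine ⟨?_, ?_, ?_, ?_⟩ <;> rw [hres]
        · rw [if_neg (by omega), if_neg (by omega), if_neg (by omega), if_pos ⟨rfl, rfl⟩]
        · rw [if_neg (by omega), if_neg (by omega), if_pos ⟨rfl, rfl⟩]
        · rw [if_neg (by omega), if_pos ⟨rfl, rfl⟩]
        · rw [if_pos ⟨rfl, rfl⟩]
      · refine ⟨?_, ?_, ?_, ?_⟩ <;>
          rw [hres, if_neg (by omega), if_neg (by omega), if_neg (by omega), if_neg (by omega)]
        exacts [h.1, h.2.1, h.2.2.1, h.2.2.2]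
    refine Within.seq (T := 7) (T' := 4) (within_ifEq (T := 5) (fun c1 => ?_) fun c1 => ?_)
    · rw [kf 11 (by norm_num), kf 1 (by norm_num), hu', g1] at c1
      refine (within_ifEq (T := 1) (fun c2 => within_instr ?_) fun c2 => within_instr ?_).mono
        (by norm_num) fun _ h => h
      all_goals rw [kf 12 (by norm_num), kf 5 (by norm_num), hv', g5] at c2
      all_goals
        refine key _ rfl rfl ?_ ?_ ?_ ?_ <;>
          simp [RAMInstr.exec, k1, k2, k3, k4, k5, kingsFst, kingsMid, kingsSnd, c1, c2]
    · rw [kf 11 (by norm_num), kf 1 (by norm_num), hu', g1] at c1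
      refine within_ifEq (T := 3) (fun c2 => (within_instr ?_).mono (by norm_num) fun _ h => h)
        fun c2 => within_ifEq (T := 1) (fun c3 => within_instr ?_) fun c3 => within_instr ?_
      all_goals rw [kf 12 (by norm_num), kf 5 (by norm_num), hv', g5] at c2
      -- `c3` and `c4` are placeholders in this branch, so that one closing tactic serves all three.
      on_goal 1 => have c3 := c1; have c4 := c1
      on_goal 2 =>
        rw [kf 11 (by norm_num), kf 12 (by norm_num), hu', hv'] at c3
        have c4 : v ≠ x := c3 ▸ c1
      on_goal 3 =>
        rw [kf 11 (by norm_num), kf 12 (by norm_num), hu', hv'] at c3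
        have c4 := c1
      all_goals
        refine key _ rfl rfl ?_ ?_ ?_ ?_ <;>
          simp [RAMInstr.exec, k1, k2, k3, k4, k5, kingsFst, kingsMid, kingsSnd, c1, c2, c3, c4, kW,
            kf 1, kf 11, g1, hu']
  · obtain ⟨h8, h9, h10⟩ := h
    refine ⟨fun r hr => by rw [h8 r (by omega), hf r hr], by rw [h8 6 (by norm_num), h6],
      by rw [h8 7 (by norm_num), h7], by rw [h9, hm], fun p hp q hq => ?_⟩
    change _ = kingsCap n x y W p q
    unfold kingsCap
    split_ifs with hpn hqn hqn
    · exact (h10 p hpn q hqn).1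
    · have := (h10 p hpn (q - n) (by omega)).2.1
      rwa [show n + (q - n) = q by omega] at this
    · have := (h10 (p - n) (by omega) q hqn).2.2.1
      rwa [show n + (p - n) = p by omega] at this
    · have := (h10 (p - n) (by omega) (q - n) (by omega)).2.2.2
      rwa [show n + (p - n) = p by omega, show n + (q - n) = q by omega] at this

/-! ### Polynomial running time and the three solutions. -/

/-- `f` is a polynomial function. -/
def IsPolynomial (f : ℕ → ℕ) : Prop := ∃ p : Polynomial ℕ, ∀ n, f n = p.eval n

theorem isPolynomial_id : IsPolynomial fun n => n := ⟨.X, fun n => by simp⟩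

theorem isPolynomial_const (c : ℕ) : IsPolynomial fun _ => c := ⟨.C c, fun n => by simp⟩

theorem IsPolynomial.add {f g : ℕ → ℕ} (hf : IsPolynomial f) (hg : IsPolynomial g) :
    IsPolynomial fun n => f n + g n := by
  obtain ⟨p, hp⟩ := hf
  obtain ⟨q, hq⟩ := hg
  exact ⟨p + q, fun n => by simp [hp, hq]⟩

theorem IsPolynomial.forTime {f g : ℕ → ℕ} (hf : IsPolynomial f) (hg : IsPolynomial g) :
    IsPolynomial fun n => forTime (f n) (g n) := by
  obtain ⟨p, hp⟩ := hf
  obtain ⟨q, hq⟩ := hg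
  exact ⟨p * (q + 2) + 2, fun n => by simp [RAMProgram.forTime, hp, hq]⟩

theorem IsPolynomial.bestCutTime {f g : ℕ → ℕ} (hf : IsPolynomial f) (hg : IsPolynomial g) :
    IsPolynomial fun n => bestCutTime n (f n) (g n) := by
  have hc := isPolynomial_const
  have h1 := (hf.forTime (hc 2)).add ((hc 1).add (hf.forTime (hc 13)))
  have h2 := hf.forTime (hf.forTime ((hf.forTime (hf.forTime (hf.forTime (hc 23)))).add
    ((hf.forTime (hc 5)).add (hc 1))))
  exact (hc 2).add (isPolynomial_id.forTime ((hg.add (h1.add (h2.add (hc 5)))).add (hc 2)))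

end RAMProgram

open RAMProgram

theorem movInput_numArr {n : ℕ} (T : Tournament (Fin n)) (w : T.Edge → ℝ) (x a b : Fin n) :
    (movInput T w x).numArr 0 a b = T.weight w a b := by
  by_cases h : T.Adj a b
  · rw [Tournament.weight, dif_pos h]
    exact dif_pos ⟨rfl, a.isLt, b.isLt, h⟩
  · rw [T.weight_of_not_adj h]
    refine dif_neg ?_
    rintro ⟨-, _, _, h'⟩
    exact h h'

theorem movInput_numArr_nonneg {n : ℕ} {T : Tournament (Fin n)} {w : T.Edge → ℝ}
    (hw : ∀ e, 0 < w e) (x : Fin n) (p q : ℕ) : 0 ≤ (movInput T w x).numArr 0 p q := by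
  simp only [movInput]
  split_ifs
  · exact (hw _).le
  · exact le_rfl

theorem movInput_numArr_self {n : ℕ} (T : Tournament (Fin n)) (w : T.Edge → ℝ) (x : Fin n)
    (p : ℕ) : (movInput T w x).numArr 0 p p = 0 := by
  simp only [movInput]
  refine dif_neg ?_
  rintro ⟨-, _, _, h'⟩
  exact T.irrefl _ h'

/-- The margin of victory is computed by the minimum cuts of a family of networks if the cuts
and the destructive reversal sets bound each other. -/
theorem winnerMoVInPolyTime_of_cuts {S : ∀ n : ℕ, Tournament (Fin n) → Set (Fin n)}
    (setup : RAMInstr) (build : RAMProgram) (N T : ℕ → ℕ) (t : ℕ → ℕ → ℕ)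
    (c : ℕ → ℕ → (ℕ → ℕ → ℝ) → ℕ → ℕ → ℕ → ℝ) (hN : IsPolynomial N) (hT : IsPolynomial T)
    (hnN : ∀ n, n ≤ N n)
    (hsetup : ∀ (n : ℕ) (τ : RAMStore), τ.idx 0 = n →
      setup.exec τ = { τ with idx := Function.update τ.idx 4 (N n) })
    (hb : ∀ n x W, Builds build n x W (N n) x (t n) (c n x W) (T n))
    (ht : ∀ n, ∀ y < n, t n y < N n) (hst : ∀ n, ∀ x < n, ∀ y < n, y ≠ x → x ≠ t n y)
    (hc : ∀ n x W, (∀ p q, 0 ≤ W p q) → ∀ y p q, 0 ≤ c n x W y p q)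
    (h1 : ∀ (n : ℕ) (T : Tournament (Fin n)) (w : T.Edge → ℝ), (∀ e, 0 < w e) → ∀ x y : Fin n,
      y ≠ x → ∀ z ∈ cutValues (N n) (c n x ((movInput T w x).numArr 0) y) x (t n y),
        ∃ R, x ∉ S n (T.reverse R) ∧ T.cost w R ≤ z)
    (h2 : ∀ (n : ℕ) (T : Tournament (Fin n)) (w : T.Edge → ℝ), (∀ e, 0 < w e) →
      ∀ (x : Fin n) (R : Finset T.Edge), x ∉ S n (T.reverse R) → ∃ y ≠ x,
        ∃ z ∈ cutValues (N n) (c n x ((movInput T w x).numArr 0) y) x (t n y), z ≤ T.cost w R) :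
    WinnerMoVInPolyTime S := by
  obtain ⟨p, hp⟩ := hN.bestCutTime hT
  refine ⟨bestCut setup build, p, fun n hn T w hw x hx => ?_⟩
  have hmain := within_bestCut (setup := setup) (build := build) (σ := movInput T w x)
    (n := n) (x := x) (t := t n) (W := (movInput T w x).numArr 0) hn (by simp [movInput])
    (by simp [movInput]) (by simp [movInput]) rfl rfl (by simp [RAMStore.flow, movInput])
    (hsetup n) (hb n x _) (x.isLt.trans_le (hnN n)) (fun y hy _ => ht n y hy)
    (fun y hy hyx => hst n x x.isLt y hy hyx)
    (fun y _ u _ v _ => hc n x _ (movInput_numArr_nonneg hw x) y u v)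
  obtain ⟨k, σ, h3, h4, h5⟩ := hmain
  refine ⟨k, σ, h3, by rw [← hp]; exact h4, Tournament.isMoV_of_isLeast hx h5 ?_ fun R hR => ?_⟩
  · rintro z ⟨y, hy, hyx, hz⟩
    exact h1 n T w hw x ⟨y, hy⟩ (fun h => hyx (congrArg Fin.val h)) z hz
  · obtain ⟨y, hyx, z, hz, hzR⟩ := h2 n T w hw x R hR
    exact ⟨z, ⟨y, y.isLt, fun h => hyx (Fin.ext h), hz⟩, hzR⟩

/-- The case of networks on the set of alternatives, with those arcs that satisfy `P`. -/
theorem winnerMoVInPolyTime_of_arcs {S : ∀ n : ℕ, Tournament (Fin n) → Set (Fin n)}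
    (P : ℕ → ℕ → ℕ → ℕ → Prop) [∀ x y a b, Decidable (P x y a b)] (build : RAMProgram)
    (T : ℕ → ℕ) (hT : IsPolynomial T)
    (hb : ∀ n x W, Builds build n x W n x id (fun y a b => if P x y a b then W a b else 0) (T n))
    (h1 : ∀ (n : ℕ) (T : Tournament (Fin n)) (x y : Fin n) (C : Set (Fin n)), x ∈ C → y ∉ C →
      x ∉ S n (T.reverse (T.edgesWith fun a b => P x y a b ∧ a ∈ C ∧ b ∉ C)))
    (h2 : ∀ (n : ℕ) (T : Tournament (Fin n)) (x : Fin n), x ∉ S n T → ∃ y ≠ x,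
      ∃ C : Set (Fin n), x ∈ C ∧ y ∉ C ∧ ∀ a ∈ C, ∀ b ∉ C, P x y a b → ¬ T.Adj a b) :
    WinnerMoVInPolyTime S := by
  classical
  refine winnerMoVInPolyTime_of_cuts (.idxCopy 4 0) build (fun n => n) T (fun _ => id)
    (fun _ x W y a b => if P x y a b then W a b else 0) isPolynomial_id hT (fun _ => le_rfl)
    (fun n τ h => by rw [← h]; rfl) hb (fun _ _ h => h) (fun _ _ _ _ _ h => h.symm) ?_ ?_ ?_
  · intro n x W hW y p q
    split_ifs
    exacts [hW p q, le_rfl]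
  · rintro n T w hw x y - z ⟨C, hx, hy, rfl⟩
    refine ⟨_, h1 n T x y {a | (a : ℕ) ∈ C} hx hy, ?_⟩
    rw [Tournament.cost_edgesWith, cutValue]
    simp only [Finset.sum_range, movInput_numArr]
    refine le_of_eq (Finset.sum_congr rfl fun a _ => Finset.sum_congr rfl fun b _ => ?_)
    by_cases hP : P x y a b <;> simp [hP]
  · intro n T w hw x R hR
    obtain ⟨y, hyx, C, hx, hy, h⟩ := h2 n _ x hR
    -- Every arc of the network that crosses this cut is absent after the reversal, so its weight
    -- occurs in the cost of `R`.
    refine ⟨y, hyx, _, ⟨Fin.val '' C, ⟨x, hx, rfl⟩, ?_, rfl⟩, ?_⟩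
    · rintro ⟨y', hy', h'⟩
      exact hy (Fin.ext h' ▸ hy')
    · rw [Tournament.cost_eq_sum_not_adj, cutValue]
      simp only [Finset.sum_range, movInput_numArr, Fin.val_injective.mem_set_image]
      refine Finset.sum_le_sum fun a _ => Finset.sum_le_sum fun b _ => ?_
      have h0 := Tournament.weight_nonneg hw a b
      split_ifs with h3 h4 h5 h5 h5
      · exact absurd h5 (h a h3.1 b h3.2 h4)
      · exact le_rfl
      · exact le_rfl
      · exact h0
      · exact le_rfl
      · exact h0

theorem winnerMoVInPolyTime_topCycle : WinnerMoVInPolyTime fun _ T => T.topCycle :=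
  winnerMoVInPolyTime_of_arcs (fun _ _ _ _ => True) (buildArcs topCycleArc) _
    ((isPolynomial_const 2).add
      (isPolynomial_id.forTime (isPolynomial_id.forTime (isPolynomial_const 2))))
    (fun n x W => by simpa using builds_topCycle n x W)
    (fun n T x y C hx hy => by simpa using Tournament.notMem_topCycle_reverse hx hy)
    (fun n T x hx => by simpa using Tournament.exists_of_notMem_topCycle hx)

theorem winnerMoVInPolyTime_uncoveredSet : WinnerMoVInPolyTime fun _ T => T.uncoveredSet :=
  winnerMoVInPolyTime_of_arcs (fun x y a b => a = x ∨ b = y) (buildArcs uncoveredSetArc) _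
    ((isPolynomial_const 2).add
      (isPolynomial_id.forTime (isPolynomial_id.forTime (isPolynomial_const 6))))
    builds_uncoveredSet
    (fun n T x y C hx hy => by
      simpa only [Fin.val_inj] using Tournament.notMem_uncoveredSet_reverse hx hy)
    (fun n T x hx => by
      simpa only [Fin.val_inj] using Tournament.exists_of_notMem_uncoveredSet hx)

theorem winnerMoVInPolyTime_kings : WinnerMoVInPolyTime fun _ T => T.kings 3 := by
  classical
  refine winnerMoVInPolyTime_of_cuts (.idxAdd 4 0 0) kingsBuild (fun n => n + n) _
    (fun n y => n + y) (fun n x W y => kingsCap n x y W) (isPolynomial_id.add isPolynomial_id)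
    ((isPolynomial_const 2).add
      (isPolynomial_id.forTime (isPolynomial_id.forTime (isPolynomial_const 17))))
    (fun n => Nat.le_add_left n n) (fun n τ h => by rw [← h]; rfl) builds_kings
    (fun n y hy => Nat.add_lt_add_left hy n) (fun n x hx y _ _ => by omega)
    (fun n x W hW y p q => kingsCap_nonneg hW p q) ?_ ?_
  · rintro n T w hw x y hyx z ⟨C, hx, hy, rfl⟩
    refine ⟨_, Tournament.notMem_kings_reverse (C₁ := {a : Fin n | (a : ℕ) ∈ C})
      (C₂ := {a | n + (a : ℕ) ∈ C}) hyx, ?_⟩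
    rw [Tournament.cost_edgesWith]
    simpa only [movInput_numArr] using sum_kingsReversal_le hyx (movInput_numArr_nonneg hw x)
      (movInput_numArr_self T w x) hx hy
  · intro n T w hw x R hR
    obtain ⟨y, hyx, h1, h2, h3⟩ := Tournament.exists_of_notMem_kings hR
    obtain ⟨z, hz, hzR⟩ := exists_cutValue_kingsCap_le hyx (movInput_numArr_nonneg hw x) h1 h2 h3
      (movInput_numArr_self T w x)
    refine ⟨y, hyx, z, hz, ?_⟩
    rw [Tournament.cost_eq_sum_not_adj]
    simpa only [movInput_numArr] using hzR

theorem mainTheorem4 :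
    WinnerMoVInPolyTime (fun _ T => T.uncoveredSet) ∧
    WinnerMoVInPolyTime (fun _ T => T.kings 3) ∧
    WinnerMoVInPolyTime (fun _ T => T.topCycle) :=
  ⟨winnerMoVInPolyTime_uncoveredSet, winnerMoVInPolyTime_kings, winnerMoVInPolyTime_topCycle⟩
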